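/- Let $F$ be the cdf of a continuous probability distribution with density $f$, supported over an interval $D_F\subseteq[0,\infty)$, and suppose that $F$ has monotone hazard rate (MHR), i.e. $x\mapsto \frac{1-F(x)}{f(x)}$ is nonincreasing on $D_F$. A single item is sold to $n\ge 2$ bidders whose valuations are i.i.d. draws from $F$; let $X_{n:n}$ be the largest of them. Let $\mathrm{PRICE}(F,n)=\sup_{p\in D_F}p\,(1-F(p)^n)$ be the best expected revenue from offering one and the same take-it-or-leave-it price to all bidders, and let $\mathrm{MYERSON}(F,n)=\mathbb E\left[\max\{0,\phi(X_{n:n})\}\right]$ with $\phi(x)=x-\frac{1-F(x)}{f(x)}$ be the optimal revenue. Let $\mathrm{APX}(F,n)=\mathrm{MYERSON}(F,n)/\mathrm{PRICE}(F,n)$ and $H_n=\sum_{i=1}^n \frac1i$. Then $0<\mathrm{PRICE}(F,n)<\infty$ and $$\mathrm{APX}(F,n)\le B(n):=\max_{q\in[1/e,1]}\min\left\{\frac{1}{1-(1-e^{-H_n+1})^n}+\frac{q(1-q)^{n-1}}{1-(1-q)^n},\ \frac{\int_0^q\frac{1-(1-z)^n}{z}\,dz}{1-(1-q)^n}\right\},$$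 where the maximum is attained. The same bound holds when $\mathrm{MYERSON}(F,n)$ is replaced by the supremum of the expected revenues of all (possibly randomized) individually rational auctions that are truthful in dominant strategies. Moreover, among all $n\ge 2$ the quantity $B(n)$ is largest at $n=3$, i.e. $B(n)\le B(3)$ for all $n\ge2$, and $B(3)\le 1.354$; hence the approximation ratio is at most $1.354$ for every $n\ge 2$. -/

import Mathlib

open MeasureTheory
open scoped ENNReal

noncomputable section

namespace AnonymousPricing

/-- A continuous valuation distribution: `μ` is a probability law on `ℝ` with density
(pdf) `f`, supported over an interval `D_F = μ.support` contained in `[0, ∞)`. -/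
structure IsValuationDist (μ : Measure ℝ) (f : ℝ → ℝ) : Prop where
  isProbabilityMeasure : IsProbabilityMeasure μ
  measurable_pdf : Measurable f
  pdf_nonneg : ∀ x, 0 ≤ f x
  eq_withDensity : μ = volume.withDensity (fun x => ENNReal.ofReal (f x))
  ordConnected_support : μ.support.OrdConnected
  support_subset : μ.support ⊆ Set.Ici 0

/-- The cumulative distribution function `F(x) = μ (-∞, x]`. -/
def cdf (μ : Measure ℝ) (x : ℝ) : ℝ := μ.real (Set.Iic x)

/-- `(1 - F(x)) / f(x)`, the reciprocal of the hazard rate, as an extended nonnegative number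
(equal to `∞` where `f(x) = 0` and `F(x) < 1`, and to `0` where `F(x) = 1`). -/
def invHazard (μ : Measure ℝ) (f : ℝ → ℝ) (x : ℝ) : ℝ≥0∞ :=
  ENNReal.ofReal (1 - cdf μ x) / ENNReal.ofReal (f x)

/-- A continuous monotone hazard rate (MHR) distribution: `-(1 - F(x)) / f(x)` is
nondecreasing on the support interval. -/
structure IsMHR (μ : Measure ℝ) (f : ℝ → ℝ) : Prop extends IsValuationDist μ f where
  antitoneOn_invHazard : AntitoneOn (invHazard μ f) μ.support

/-- The joint law of `n` i.i.d. valuations. -/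
def iidLaw (μ : Measure ℝ) (n : ℕ) : Measure (Fin n → ℝ) := Measure.pi (fun _ => μ)

/-! ### Anonymous pricing -/

/-- Expected revenue `p (1 - F(p)^n)` of the take-it-or-leave-it price `p`. -/
def priceRevenue (μ : Measure ℝ) (n : ℕ) (p : ℝ) : ℝ := p * (1 - cdf μ p ^ n)

/-- The optimal revenue by anonymous pricing, `sup_{p ∈ D_F} p (1 - F(p)^n)`. -/
def optPrice (μ : Measure ℝ) (n : ℕ) : ℝ≥0∞ :=
  ⨆ p ∈ μ.support, ENNReal.ofReal (priceRevenue μ n p)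

/-! ### The optimal revenue -/

/-- The virtual valuation `φ(x) = x - (1 - F(x)) / f(x)`. It is only used under an expectation;
the points where `f` vanishes form a null set of the distribution. -/
def virtualValue (μ : Measure ℝ) (f : ℝ → ℝ) (x : ℝ) : ℝ := x - (1 - cdf μ x) / f x

/-- Myerson's optimal revenue `E[max {0, φ(X_{n:n})}]`, where `X_{n:n}` is the maximum of
`n` i.i.d. valuations. -/
def myerson (μ : Measure ℝ) (f : ℝ → ℝ) (n : ℕ) : ℝ≥0∞ :=
  ∫⁻ v, ENNReal.ofReal (max 0 (virtualValue μ f (⨆ i, v i))) ∂(iidLaw μ n)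

/-- A (possibly randomized) direct single-item auction for `n` bidders with i.i.d. valuations
from `μ`: given the bids `v`, `alloc v i` is the probability that bidder `i` wins and `pay v i`
the expected payment of bidder `i`. It is feasible, individually rational, and truthful
(in dominant strategies) for all valuations in the support. -/
structure TruthfulAuction (μ : Measure ℝ) (n : ℕ) where
  alloc : (Fin n → ℝ) → Fin n → ℝ
  pay : (Fin n → ℝ) → Fin n → ℝ
  measurable_alloc : ∀ i, Measurable (fun v => alloc v i)
  measurable_pay : ∀ i, Measurable (fun v => pay v i)
  integrable_pay : ∀ i, Integrable (fun v => pay v i) (iidLaw μ n)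
  alloc_nonneg : ∀ v, (∀ j, v j ∈ μ.support) → ∀ i, 0 ≤ alloc v i
  sum_alloc_le_one : ∀ v, (∀ j, v j ∈ μ.support) → ∑ i, alloc v i ≤ 1
  individuallyRational : ∀ v, (∀ j, v j ∈ μ.support) → ∀ i, 0 ≤ v i * alloc v i - pay v i
  truthful : ∀ v, (∀ j, v j ∈ μ.support) → ∀ i, ∀ b ∈ μ.support,
    v i * alloc (Function.update v i b) i - pay (Function.update v i b) i
      ≤ v i * alloc v i - pay v i

/-- The expected revenue of an auction. -/
def TruthfulAuction.revenue {μ : Measure ℝ} {n : ℕ} (A : TruthfulAuction μ n) : ℝ :=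
  ∫ v, ∑ i, A.pay v i ∂(iidLaw μ n)

/-- The optimal expected revenue over all truthful auctions. -/
def optAuction (μ : Measure ℝ) (n : ℕ) : ℝ≥0∞ :=
  ⨆ A : TruthfulAuction μ n, ENNReal.ofReal A.revenue

/-- The approximation ratio `APX(F, n) = MYERSON(F, n) / PRICE(F, n)`. -/
def apx (μ : Measure ℝ) (f : ℝ → ℝ) (n : ℕ) : ℝ≥0∞ := myerson μ f n / optPrice μ n

/-! ### The upper bound -/

/-- The minimum of the two bounds at the quantile `q`. -/
def boundAt (n : ℕ) (q : ℝ) : ℝ :=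
  min
    (1 / (1 - (1 - Real.exp (-(harmonic n : ℝ) + 1)) ^ n)
      + q * (1 - q) ^ (n - 1) / (1 - (1 - q) ^ n))
    ((∫ z in (0 : ℝ)..q, (1 - (1 - z) ^ n) / z) / (1 - (1 - q) ^ n))

/-- The supremum of `boundAt n q` over `q ∈ [1/e, 1]`. -/
def bound (n : ℕ) : ℝ := sSup (boundAt n '' Set.Icc (1 / Real.exp 1) 1)

end AnonymousPricing

end

open MeasureTheory Set Filter Topology
open scoped ENNReal

noncomputable section

namespace AnonymousPricing

/-! Write `m = (1 - F) / f`, `P` for the optimal anonymous-price revenue, and `S(x)` for the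
probability that the second highest draw exceeds `x`. Since `m` is nonincreasing, `-log (1 - F)` is
convex, so `1 - F` lies below the exponential that touches it at any point `p` (`survival_le_exp`).
All distributional estimates come from this tangent bound.

Let `r` be the point where `φ(x) = x - m(x)` changes sign and `q = 1 - F(r)`. The tangent
exponential at `r` may be given rate `1 / r`; its value at `0` yields `q ≥ 1/e`. Integrating `max 0
φ` against the law of the maximum bounds Myerson's revenue by that of the second price auction with
reserve `r`, namely `r (1 - F(r)^n) + ∫_r^∞ S` (`myerson_le`). Two estimates of this quantity give
the two terms of the minimum.

For the second term, replace `1 - F` beyond `r` by its exponential bound. The integral is then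
explicit and the total is `r * harmonicSum n q`, while offering the price `r` shows `r ≤ P / (1 - (1
- q)^n)`.

For the first term, write `∫_r^∞ S = ∫_0^∞ S - ∫_0^r S`. The full integral is at most the price `p`
with `1 - F(p) = exp (1 - H_n)`, by comparison with a shifted exponential
(`integral_secondSurvival_le`). The part up to `r` is at least `r (1 - F(r)^(n-1))`: the odds `F /
(1 - F)` grow at most linearly up to `r`, so `F` is compared with the distribution whose odds are
exactly linear (`le_setIntegral_secondSurvival`). What remains is `p + r q (1 - q)^(n-1)`, and both
`p` and `r` are bounded through `P`.

Truthful auctions are reduced to the virtual surplus by the envelope inequality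
(`optAuction_le_myerson`). The comparison with `n = 3` is numerical: `bound 3` lies between `1.35`
and `1.354`, and every other `bound n` is at most `1.35`. -/

variable {μ : Measure ℝ} {f : ℝ → ℝ}

/-! ### The distribution function and the core of the support. -/

/-- The points at which the cumulative distribution function is neither `0` nor `1`. -/
def core (μ : Measure ℝ) : Set ℝ := {x | 0 < cdf μ x ∧ cdf μ x < 1}

lemma cdf_nonneg (x : ℝ) : 0 ≤ cdf μ x := measureReal_nonneg

lemma cdf_mono [IsProbabilityMeasure μ] : Monotone (cdf μ) := fun _ _ h =>
  measureReal_mono (Iic_subset_Iic.2 h)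

lemma cdf_le_one [IsProbabilityMeasure μ] (x : ℝ) : cdf μ x ≤ 1 := measureReal_le_one

lemma real_Ioi_eq [IsProbabilityMeasure μ] (x : ℝ) : μ.real (Ioi x) = 1 - cdf μ x := by
  rw [← compl_Iic, probReal_compl_eq_one_sub measurableSet_Iic, cdf]

lemma tendsto_cdf_atTop [IsProbabilityMeasure μ] : Tendsto (cdf μ) atTop (𝓝 1) := by
  have := ProbabilityTheory.tendsto_cdf_atTop μ
  refine this.congr fun x => ?_
  rw [ProbabilityTheory.cdf_eq_real, cdf]

namespace IsValuationDist

variable (h : IsValuationDist μ f)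
include h

lemma noAtoms : NullSingletonClass μ := by
  refine ⟨fun x => ?_⟩
  rw [h.eq_withDensity]
  exact withDensity_absolutelyContinuous _ _ (measure_singleton x)

lemma measure_eq {s : Set ℝ} (hs : MeasurableSet s) :
    μ s = ∫⁻ x in s, ENNReal.ofReal (f x) := by
  conv_lhs => rw [h.eq_withDensity, withDensity_apply _ hs]

lemma integrable_pdf : Integrable f := by
  have := h.isProbabilityMeasure
  refine ⟨h.measurable_pdf.aestronglyMeasurable, ?_⟩
  rw [hasFiniteIntegral_iff_ofReal (ae_of_all _ h.pdf_nonneg), ← setLIntegral_univ,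
    ← h.measure_eq MeasurableSet.univ]
  exact measure_lt_top _ _

lemma cdf_eq_integral (x : ℝ) : cdf μ x = ∫ t in Iic x, f t := by
  rw [cdf, Measure.real, h.measure_eq measurableSet_Iic,
    integral_eq_lintegral_of_nonneg_ae (ae_of_all _ h.pdf_nonneg)
      h.measurable_pdf.aestronglyMeasurable]

lemma cdf_sub_cdf (x y : ℝ) : cdf μ y - cdf μ x = ∫ t in x..y, f t := by
  rw [h.cdf_eq_integral, h.cdf_eq_integral,
    intervalIntegral.integral_Iic_sub_Iic h.integrable_pdf.integrableOn
      h.integrable_pdf.integrableOn]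

lemma continuous_cdf : Continuous (cdf μ) := by
  have : cdf μ = fun x => cdf μ 0 + ∫ t in (0 : ℝ)..x, f t := by
    ext x
    rw [← h.cdf_sub_cdf]
    ring
  rw [this]
  exact continuous_const.add
    (intervalIntegral.continuous_primitive (fun a b => h.integrable_pdf.intervalIntegrable) 0)

lemma cdf_eq_zero {x : ℝ} (hx : x ≤ 0) : cdf μ x = 0 := by
  have := h.noAtoms
  have h1 : μ (Iio x) = 0 := by
    refine measure_mono_null ?_ (Measure.measure_compl_support (μ := μ))
    intro y hy hy'
    have := h.support_subset hy'
    simp only [mem_Ici, mem_Iio] at *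
    linarith
  rw [cdf, Measure.real, measure_congr Iio_ae_eq_Iic.symm, h1]
  rfl

lemma core_subset_support : core μ ⊆ μ.support := by
  have := h.isProbabilityMeasure
  intro x hx
  have h1 : 0 < μ (Iic x) := by
    have := hx.1
    rw [cdf, Measure.real] at this
    exact (ENNReal.toReal_pos_iff.1 this).1
  have h2 : 0 < μ (Ioi x) := by
    have := hx.2
    have h3 := real_Ioi_eq (μ := μ) x
    have : 0 < μ.real (Ioi x) := by linarith
    exact (ENNReal.toReal_pos_iff.1 this).1
  obtain ⟨y, hy, hy'⟩ := Measure.nonempty_inter_support_of_pos h1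
  obtain ⟨z, hz, hz'⟩ := Measure.nonempty_inter_support_of_pos h2
  exact h.ordConnected_support.out hy' hz' ⟨hy, le_of_lt hz⟩

lemma pos_of_mem_core {x : ℝ} (hx : x ∈ core μ) : 0 < x := by
  by_contra hc
  exact hx.1.ne' (h.cdf_eq_zero (not_lt.1 hc))

lemma ordConnected_core : (core μ).OrdConnected := by
  have := h.isProbabilityMeasure
  exact ⟨fun x hx y hy z hz => ⟨hx.1.trans_le (cdf_mono hz.1), (cdf_mono hz.2).trans_lt hy.2⟩⟩

lemma isOpen_core : IsOpen (core μ) :=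
  (isOpen_lt continuous_const h.continuous_cdf).inter (isOpen_lt h.continuous_cdf continuous_const)

lemma measurableSet_core : MeasurableSet (core μ) := h.isOpen_core.measurableSet

/-- The complement of the support is null. Within the support, `F = 0` and `F = 1` can each hold at
one point at most, and points are null. -/
lemma measure_compl_core : μ (core μ)ᶜ = 0 := by
  have := h.isProbabilityMeasure
  have := h.noAtoms
  have h0 : (μ.support ∩ {x | cdf μ x = 0}).Subsingleton := by
    have key : ∀ x ∈ μ.support, ∀ y, cdf μ y = 0 → ¬ x < y := by
      intro x hx y hy hxy
      rw [Measure.mem_support_iff_forall] at hx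
      have := hx (Iic y) (Iic_mem_nhds hxy)
      rw [cdf, Measure.real, ENNReal.toReal_eq_zero_iff] at hy
      rcases hy with hy | hy
      · exact this.ne' hy
      · exact measure_ne_top _ _ hy
    intro x hx y hy
    exact le_antisymm (not_lt.1 (key y hy.1 x hx.2)) (not_lt.1 (key x hx.1 y hy.2))
  have h1 : (μ.support ∩ {x | cdf μ x = 1}).Subsingleton := by
    have key : ∀ x ∈ μ.support, ∀ y, cdf μ y = 1 → ¬ y < x := by
      intro x hx y hy hxy
      rw [Measure.mem_support_iff_forall] at hx
      have := hx (Ioi y) (Ioi_mem_nhds hxy)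
      have h3 := real_Ioi_eq (μ := μ) y
      rw [hy, sub_self, Measure.real, ENNReal.toReal_eq_zero_iff] at h3
      rcases h3 with h3 | h3
      · exact this.ne' h3
      · exact measure_ne_top _ _ h3
    intro x hx y hy
    exact le_antisymm (not_lt.1 (key x hx.1 y hy.2)) (not_lt.1 (key y hy.1 x hx.2))
  refine measure_mono_null (t := μ.supportᶜ ∪ ((μ.support ∩ {x | cdf μ x = 0}) ∪
    (μ.support ∩ {x | cdf μ x = 1}))) ?_ ?_
  · intro x hx
    by_cases hs : x ∈ μ.support
    · right
      by_cases hx0 : cdf μ x = 0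
      · exact Or.inl ⟨hs, hx0⟩
      · refine Or.inr ⟨hs, ?_⟩
        by_contra hx1
        exact hx ⟨lt_of_le_of_ne (cdf_nonneg x) (Ne.symm hx0), lt_of_le_of_ne (cdf_le_one x) hx1⟩
    · exact Or.inl hs
  · simp [h0.measure_zero μ, h1.measure_zero μ]

lemma ae_mem_core : ∀ᵐ x ∂μ, x ∈ core μ := by
  rw [ae_iff]
  exact h.measure_compl_core

lemma ae_mem_core_or_pdf_eq_zero : ∀ᵐ x, x ∈ core μ ∨ f x = 0 := by
  have h1 := h.measure_compl_core
  rw [h.measure_eq h.measurableSet_core.compl,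
    lintegral_eq_zero_iff h.measurable_pdf.ennreal_ofReal] at h1
  have h2 := (ae_restrict_iff' h.measurableSet_core.compl).1 h1
  filter_upwards [h2] with x hx
  by_cases hc : x ∈ core μ
  · exact Or.inl hc
  · right
    have := hx hc
    simp only [Pi.zero_apply, ENNReal.ofReal_eq_zero] at this
    exact le_antisymm this (h.pdf_nonneg x)

lemma exists_cdf_eq {u : ℝ} (hu : 0 < u) (hu1 : u < 1) : ∃ x ∈ core μ, cdf μ x = u := by
  have := h.isProbabilityMeasure
  have h1 : ∀ᶠ y in atTop, u < cdf μ y := tendsto_cdf_atTop.eventually (lt_mem_nhds hu1)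
  obtain ⟨y, hy⟩ := h1.exists
  have hy0 : 0 ≤ y := by
    by_contra hc
    rw [h.cdf_eq_zero (not_le.1 hc).le] at hy
    linarith
  obtain ⟨x, -, hx⟩ := intermediate_value_Icc hy0 h.continuous_cdf.continuousOn
    (show u ∈ Icc (cdf μ 0) (cdf μ y) from ⟨by rw [h.cdf_eq_zero le_rfl]; exact hu.le, hy.le⟩)
  exact ⟨x, by constructor <;> rw [hx] <;> assumption, hx⟩

end IsValuationDist

/-! ### The exponential comparison for MHR distributions. -/

/-- The reciprocal of the hazard rate as a real number. -/
def invHazardReal (μ : Measure ℝ) (f : ℝ → ℝ) (x : ℝ) : ℝ := (1 - cdf μ x) / f x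

/-- Euler's limit `(1 + τ/N)^N → exp τ` along a subdivision from `p` to `y` turns one-step estimates
into an exponential bound, so `log (1 - F)` need not be differentiated. -/
lemma exp_mul_le_of_steps {g : ℝ → ℝ} {p y τ : ℝ}
    (hstep : ∀ N k : ℕ, k < N →
      (1 + τ / N) * g (p + (k + 1) / N * (y - p)) ≤ g (p + k / N * (y - p))) :
    Real.exp τ * g y ≤ g p := by
  have hlim : Tendsto (fun N : ℕ => (1 + τ / N) ^ N * g y) atTop (𝓝 (Real.exp τ * g y)) :=
    (Real.tendsto_one_add_div_pow_exp τ).mul_const _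
  refine le_of_tendsto hlim ?_
  obtain ⟨M, hM⟩ := exists_nat_gt |τ|
  filter_upwards [eventually_ge_atTop M, eventually_gt_atTop 0] with N hN hN0
  have hNpos : (0 : ℝ) < N := by exact_mod_cast hN0
  have h0 : 0 ≤ 1 + τ / N := by
    have h1 : |τ| ≤ N := hM.le.trans (by exact_mod_cast hN)
    have h2 : -1 ≤ τ / N := by
      rw [le_div_iff₀ hNpos]
      linarith [neg_abs_le τ]
    linarith
  have key : ∀ k : ℕ, k ≤ N → (1 + τ / N) ^ k * g (p + k / N * (y - p)) ≤ g p := by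
    intro k
    induction k with
    | zero => intro _; simp
    | succ k ih =>
      intro hk
      refine le_trans ?_ (ih (by omega))
      rw [pow_succ, mul_assoc]
      refine mul_le_mul_of_nonneg_left ?_ (pow_nonneg h0 k)
      have := hstep N k (by omega)
      push_cast
      exact this
  have := key N le_rfl
  rwa [div_self hNpos.ne', one_mul, add_sub_cancel] at this

namespace IsMHR

variable (h : IsMHR μ f)
include h

/-- A zero of `f` at `x` makes the inverse hazard rate infinite there, hence by monotonicity at all
earlier core points. Then `f` vanishes almost everywhere up to `x`, which forces `F(x) = 0`. -/
lemma pdf_pos {x : ℝ} (hx : x ∈ core μ) : 0 < f x := by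
  have := h.isProbabilityMeasure
  by_contra hc
  have hfx : f x = 0 := le_antisymm (not_lt.1 hc) (h.pdf_nonneg x)
  have htop : invHazard μ f x = ⊤ := by
    rw [invHazard, hfx, ENNReal.ofReal_zero, ENNReal.div_zero]
    have := hx.2
    simpa using this
  have hzero : ∀ y ∈ core μ, y ≤ x → f y = 0 := by
    intro y hy hyx
    have h1 := h.antitoneOn_invHazard (h.core_subset_support hy) (h.core_subset_support hx) hyx
    rw [htop, top_le_iff, invHazard] at h1
    by_contra hne
    have : 0 < f y := lt_of_le_of_ne (h.pdf_nonneg y) (Ne.symm hne)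
    exact (ENNReal.div_lt_top ENNReal.ofReal_ne_top (by simpa using this)).ne h1
  have : cdf μ x = 0 := by
    rw [h.cdf_eq_integral]
    refine integral_eq_zero_of_ae ?_
    rw [EventuallyEq, ae_restrict_iff' measurableSet_Iic]
    filter_upwards [h.ae_mem_core_or_pdf_eq_zero] with y hy hyx
    rcases hy with hy | hy
    · exact hzero y hy hyx
    · exact hy
  exact hx.1.ne' this

lemma invHazardReal_pos {x : ℝ} (hx : x ∈ core μ) : 0 < invHazardReal μ f x :=
  div_pos (by linarith [hx.2]) (h.pdf_pos hx)

lemma invHazardReal_antitoneOn : AntitoneOn (invHazardReal μ f) (core μ) := by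
  intro x hx y hy hxy
  have h1 := h.antitoneOn_invHazard (h.core_subset_support hx) (h.core_subset_support hy) hxy
  rw [invHazard, invHazard, ← ENNReal.ofReal_div_of_pos (h.pdf_pos hx),
    ← ENNReal.ofReal_div_of_pos (h.pdf_pos hy)] at h1
  exact (ENNReal.ofReal_le_ofReal_iff (h.invHazardReal_pos hx).le).1 h1

/-- A step of the right half of the exponential comparison. -/
lemma survival_step_right {p x y : ℝ} (hp : p ∈ core μ) (hpx : p ≤ x) (hxy : x ≤ y) :
    (1 + (y - x) / invHazardReal μ f p) * (1 - cdf μ y) ≤ 1 - cdf μ x := by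
  have := h.isProbabilityMeasure
  by_cases hy : cdf μ y < 1
  · have hyc : y ∈ core μ := ⟨hp.1.trans_le (cdf_mono (hpx.trans hxy)), hy⟩
    -- On `[x, y]`, `f(t) = (1 - F(t)) / m(t)` is at least `(1 - F(y)) / m(p)`, as `p ≤ t ≤ y`.
    have h2 : ∫ t in x..y, (1 - cdf μ y) / invHazardReal μ f p ≤ ∫ t in x..y, f t := by
      refine intervalIntegral.integral_mono_on hxy intervalIntegrable_const
        h.integrable_pdf.intervalIntegrable fun t ht => ?_
      have htc : t ∈ core μ := h.ordConnected_core.out hp hyc ⟨hpx.trans ht.1, ht.2⟩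
      have h3 := h.invHazardReal_antitoneOn hp htc (hpx.trans ht.1)
      have h4 := h.pdf_pos htc
      rw [div_le_iff₀ (h.invHazardReal_pos hp)]
      have h5 : 1 - cdf μ t = f t * invHazardReal μ f t := by
        rw [invHazardReal]; field_simp
      have h6 := cdf_mono (μ := μ) ht.2
      have h7 := mul_le_mul_of_nonneg_left h3 h4.le
      linarith
    rw [← h.cdf_sub_cdf, intervalIntegral.integral_const, smul_eq_mul] at h2
    have : (1 + (y - x) / invHazardReal μ f p) * (1 - cdf μ y) =
      (1 - cdf μ y) + (y - x) * ((1 - cdf μ y) / invHazardReal μ f p) := by ring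
    linarith
  · have : cdf μ y = 1 := le_antisymm (cdf_le_one y) (not_lt.1 hy)
    rw [this, sub_self, mul_zero]
    linarith [cdf_le_one (μ := μ) x]

/-- A step of the left half of the exponential comparison. -/
lemma survival_step_left {p x y : ℝ} (hp : p ∈ core μ) (hyp : y ≤ p) (hxy : x ≤ y) :
    (1 + (x - y) / invHazardReal μ f p) * (1 - cdf μ x) ≤ 1 - cdf μ y := by
  have := h.isProbabilityMeasure
  have h2 : ∫ t in x..y, f t ≤ ∫ t in x..y, (1 - cdf μ x) / invHazardReal μ f p := by
    refine intervalIntegral.integral_mono_ae_restrict hxy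
      h.integrable_pdf.intervalIntegrable intervalIntegrable_const ?_
    rw [EventuallyLE, ae_restrict_iff' measurableSet_Icc]
    -- To the left of `p` the interval may leave the core, where the hazard rate gives no control;
    -- there `f = 0` almost everywhere.
    filter_upwards [h.ae_mem_core_or_pdf_eq_zero] with t htc ht
    rcases htc with htc | htc
    · have h3 := h.invHazardReal_antitoneOn htc hp (ht.2.trans hyp)
      have h4 := h.pdf_pos htc
      rw [le_div_iff₀ (h.invHazardReal_pos hp)]
      have h5 : 1 - cdf μ t = f t * invHazardReal μ f t := by
        rw [invHazardReal]; field_simp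
      have h6 := cdf_mono (μ := μ) ht.1
      have h7 := mul_le_mul_of_nonneg_left h3 h4.le
      linarith
    · rw [htc]
      exact div_nonneg (by linarith [cdf_le_one (μ := μ) x]) (h.invHazardReal_pos hp).le
  rw [← h.cdf_sub_cdf, intervalIntegral.integral_const, smul_eq_mul] at h2
  have : (1 + (x - y) / invHazardReal μ f p) * (1 - cdf μ x) =
    (1 - cdf μ x) - (y - x) * ((1 - cdf μ x) / invHazardReal μ f p) := by ring
  linarith

/-- The survival function lies below the exponential through `p` with the hazard rate of `p`. -/
lemma survival_le_exp {p : ℝ} (hp : p ∈ core μ) (y : ℝ) :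
    1 - cdf μ y ≤ (1 - cdf μ p) * Real.exp (-(y - p) / invHazardReal μ f p) := by
  have hm := h.invHazardReal_pos hp
  have key : Real.exp ((y - p) / invHazardReal μ f p) * (1 - cdf μ y) ≤ 1 - cdf μ p := by
    refine exp_mul_le_of_steps (g := fun t => 1 - cdf μ t) fun N k hk => ?_
    have hN : (0 : ℝ) < N := by exact_mod_cast (Nat.zero_le k).trans_lt hk
    have hkN : (0 : ℝ) ≤ k / N := by positivity
    have hk1 : ((k : ℝ) + 1) / N = k / N + 1 / N := by ring
    have hN1 : (0 : ℝ) < 1 / N := by positivity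
    have hd : (y - p) / invHazardReal μ f p / N =
      (p + (k + 1) / N * (y - p) - (p + k / N * (y - p))) / invHazardReal μ f p := by ring
    rw [hd]
    rcases le_total p y with hy | hy
    · exact h.survival_step_right hp (by nlinarith) (by rw [hk1]; nlinarith)
    · exact h.survival_step_left hp (by nlinarith) (by rw [hk1]; nlinarith)
  rw [neg_div, Real.exp_neg, ← div_eq_mul_inv, le_div_iff₀ (Real.exp_pos _)]
  linarith

end IsMHR

/-! ### The optimal reserve price. -/

/-- `r` is an optimal reserve price: the virtual value changes sign at `r`, and the survival
function lies below the exponential through `r` with rate `1 / r`. -/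
structure IsReserve (μ : Measure ℝ) (f : ℝ → ℝ) (r : ℝ) : Prop where
  pos : 0 < r
  mem_support : r ∈ μ.support
  survival_le : ∀ y, 1 - cdf μ y ≤ (1 - cdf μ r) * Real.exp (-(y - r) / r)
  invHazardReal_le : ∀ x ∈ core μ, r < x → invHazardReal μ f x ≤ x
  lt_invHazardReal : ∀ x ∈ core μ, x < r → x < invHazardReal μ f x

namespace IsMHR

variable (h : IsMHR μ f)
include h

/-- If `m(x) > x` throughout the core, the tangent bound at `x` gives `1 - F(y) ≤ e (1 - F(x))` for
all `y > 0`. The median `y` and an `x` of survival probability `1 / (4e)` then yield `1/2 ≤ 1/4`. -/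
lemma exists_invHazardReal_le : ∃ x ∈ core μ, invHazardReal μ f x ≤ x := by
  by_contra! hc
  obtain ⟨y, hy, hy'⟩ := h.exists_cdf_eq (u := 1 / 2) (by norm_num) (by norm_num)
  have he : 0 < Real.exp (-1) := Real.exp_pos _
  have he1 : Real.exp (-1) < 1 := by simp
  obtain ⟨x, hx, hx'⟩ := h.exists_cdf_eq (u := 1 - Real.exp (-1) / 4) (by linarith) (by linarith)
  have h1 := h.survival_le_exp hx y
  have hm := h.invHazardReal_pos hx
  have h2 : -(y - x) / invHazardReal μ f x ≤ 1 := by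
    rw [div_le_one hm]
    linarith [hc x hx, h.pos_of_mem_core hy]
  have h3 : Real.exp (-(y - x) / invHazardReal μ f x) ≤ Real.exp 1 := Real.exp_le_exp.2 h2
  have h4 : Real.exp (-1) * Real.exp 1 = 1 := by rw [← Real.exp_add]; simp
  rw [hy', hx'] at h1
  nlinarith

/-- The reserve is the infimum of the core points with `m(x) ≤ x`. It may be the left endpoint of
the support, and `m` may jump across the value `r` there, so the exponential bound with rate `1 / r`
is a limit of tangent bounds at `t → r`: from the left, where `m(t) ≥ r`, for `y < r`, and from the
right, where `m(t) ≤ r`, for `y > r`. -/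
lemma exists_isReserve : ∃ r, IsReserve μ f r := by
  have := h.isProbabilityMeasure
  set S := {x | x ∈ core μ ∧ invHazardReal μ f x ≤ x} with hS
  have hne : S.Nonempty := h.exists_invHazardReal_le
  have hbdd : BddBelow S := ⟨0, fun x hx => (h.pos_of_mem_core hx.1).le⟩
  set r := sInf S with hr
  have hup : ∀ s ∈ S, ∀ x ∈ core μ, s ≤ x → x ∈ S := fun s hs x hx hsx =>
    ⟨hx, (h.invHazardReal_antitoneOn hs.1 hx hsx).trans (hs.2.trans hsx)⟩
  have hright : ∀ x ∈ core μ, r < x → invHazardReal μ f x ≤ r := by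
    intro x hx hrx
    refine le_of_forall_gt_imp_ge_of_dense fun c hc => ?_
    obtain ⟨s, hs, hsc⟩ := exists_lt_of_csInf_lt hne (lt_min hc hrx)
    exact (h.invHazardReal_antitoneOn hs.1 hx (hsc.le.trans (min_le_right _ _))).trans
      (hs.2.trans (hsc.le.trans (min_le_left _ _)))
  have hleft : ∀ x ∈ core μ, x < r → x < invHazardReal μ f x := by
    intro x hx hxr
    by_contra hc
    exact absurd (csInf_le hbdd (show x ∈ S from ⟨hx, not_lt.1 hc⟩)) (not_le.2 hxr)
  -- The core is open, so it contains points strictly to the right of `r` along which the limit can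
  -- be taken.
  obtain ⟨s₀, hs₀, hrs₀⟩ : ∃ s ∈ S, r < s := by
    obtain ⟨s, hs⟩ := hne
    have h1 : ∀ᶠ t in 𝓝[>] s, t ∈ core μ :=
      mem_nhdsWithin_of_mem_nhds (h.isOpen_core.mem_nhds hs.1)
    obtain ⟨t, ht, hst⟩ := (h1.and self_mem_nhdsWithin).exists
    exact ⟨t, hup s hs t ht (le_of_lt hst), (csInf_le hbdd hs).trans_lt hst⟩
  have hcore : ∀ t, r < t → t ≤ s₀ → t ∈ core μ := by
    intro t hrt hts
    obtain ⟨s, hs, hst⟩ := exists_lt_of_csInf_lt hne hrt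
    exact h.ordConnected_core.out hs.1 hs₀.1 ⟨hst.le, hts⟩
  have hpos : 0 < r := (h.invHazardReal_pos hs₀.1).trans_le (hright s₀ hs₀.1 hrs₀)
  have hcont : ∀ y, ContinuousAt (fun t => (1 - cdf μ t) * Real.exp (-(y - t) / r)) r := by
    intro y
    have := h.continuous_cdf
    fun_prop
  refine ⟨r, hpos, ?_, ?_, fun x hx hxr => (hright x hx hxr).trans hxr.le, hleft⟩
  · have h1 : ∀ᶠ t in 𝓝[>] r, t ∈ μ.support := by
      filter_upwards [Ioc_mem_nhdsGT hrs₀] with t ht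
      exact h.core_subset_support (hcore t ht.1 ht.2)
    exact Measure.isClosed_support.mem_of_frequently_of_tendsto h1.frequently
      (tendsto_id.mono_left nhdsWithin_le_nhds)
  · intro y
    rcases lt_trichotomy y r with hy | hy | hy
    · by_cases hFr : 0 < cdf μ r
      · have hrc : r ∈ core μ := ⟨hFr, (cdf_mono hrs₀.le).trans_lt hs₀.1.2⟩
        have h1 : ∀ᶠ t in 𝓝[<] r, t ∈ core μ :=
          mem_nhdsWithin_of_mem_nhds (h.isOpen_core.mem_nhds hrc)
        refine ge_of_tendsto ((hcont y).tendsto.mono_left nhdsWithin_le_nhds :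
          Tendsto _ (𝓝[<] r) _) ?_
        filter_upwards [h1, Ioo_mem_nhdsLT hy] with t htc ht
        have h2 : r ≤ invHazardReal μ f t := by
          refine le_of_forall_lt_imp_le_of_dense fun c hc => ?_
          have h3 : max c t < r := max_lt hc ht.2
          have h4 : max c t ∈ core μ :=
            h.ordConnected_core.out htc hrc ⟨le_max_right _ _, h3.le⟩
          exact (le_max_left c t).trans ((hleft _ h4 h3).le.trans
            (h.invHazardReal_antitoneOn htc h4 (le_max_right _ _)))
        refine (h.survival_le_exp htc y).trans ?_
        refine mul_le_mul_of_nonneg_left (Real.exp_le_exp.2 ?_) (by linarith [htc.2])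
        exact div_le_div_of_nonneg_left (by linarith [ht.1]) hpos h2
      -- With no mass below `r` there is no core point to approach from, but the exponential is
      -- already at least `1`.
      · have hF : cdf μ r = 0 := le_antisymm (not_lt.1 hFr) (cdf_nonneg r)
        rw [hF, sub_zero, one_mul]
        have h1 : 1 ≤ Real.exp (-(y - r) / r) :=
          Real.one_le_exp (div_nonneg (by linarith) hpos.le)
        linarith [cdf_nonneg (μ := μ) y]
    · rw [hy]; simp
    · refine ge_of_tendsto ((hcont y).tendsto.mono_left nhdsWithin_le_nhds :
          Tendsto _ (𝓝[>] r) _) ?_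
      filter_upwards [Ioc_mem_nhdsGT hrs₀, Ioo_mem_nhdsGT hy] with t ht ht'
      have htc := hcore t ht.1 ht.2
      refine (h.survival_le_exp htc y).trans ?_
      refine mul_le_mul_of_nonneg_left (Real.exp_le_exp.2 ?_) (by linarith [htc.2])
      rw [neg_div, neg_div, neg_le_neg_iff]
      exact div_le_div_of_nonneg_left (by linarith [ht'.2]) (h.invHazardReal_pos htc)
        (hright t htc ht.1)

end IsMHR

namespace IsReserve

variable {r : ℝ} (hr : IsReserve μ f r) (h : IsMHR μ f)
include hr h

/-- At `0` the survival probability is `1` and the exponential through `r` is `e (1 - F(r))`. This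
is the source of the range `[1/e, 1]` of quantiles. -/
lemma exp_neg_one_le : 1 / Real.exp 1 ≤ 1 - cdf μ r := by
  have h1 := hr.survival_le 0
  have hp := hr.pos
  have h2 : -(0 - r) / r = 1 := by field_simp; ring
  rw [h.cdf_eq_zero le_rfl, h2, sub_zero] at h1
  rwa [div_le_iff₀ (Real.exp_pos 1)]

lemma survival_pos : 0 < 1 - cdf μ r :=
  lt_of_lt_of_le (by positivity) (hr.exp_neg_one_le h)

end IsReserve

/-- The odds against exceeding a price grow at most linearly up to any point of positive
survival probability. -/
lemma IsMHR.cdf_mul_le (h : IsMHR μ f) {x r : ℝ} (hx : 0 ≤ x) (hxr : x ≤ r)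
    (hr : cdf μ r < 1) :
    cdf μ x * (1 - cdf μ r) * r ≤ (1 - cdf μ x) * (cdf μ r * x) := by
  have := h.isProbabilityMeasure
  by_cases hF : 0 < cdf μ x
  · have hxc : x ∈ core μ := ⟨hF, (cdf_mono hxr).trans_lt hr⟩
    have hx0 := h.pos_of_mem_core hxc
    set a := 1 / invHazardReal μ f x with ha
    set G := 1 - cdf μ x with hG
    set Q := 1 - cdf μ r with hQ
    have hGp : 0 < G := by rw [hG]; linarith [hxc.2]
    have h1 : 1 ≤ G * Real.exp (a * x) := by
      have := h.survival_le_exp hxc 0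
      rw [h.cdf_eq_zero le_rfl, sub_zero] at this
      convert this using 3
      rw [ha]; ring
    have h2 : Q ≤ G * Real.exp (-(a * (r - x))) := by
      convert h.survival_le_exp hxc r using 3
      rw [ha]; ring
    have h3 : Real.exp (-(a * x)) ≤ G := by
      rw [Real.exp_neg, inv_le_iff_one_le_mul₀ (Real.exp_pos _)]
      exact h1
    have h4 : Q * (1 + a * (r - x)) ≤ G := by
      have h5 : Q * Real.exp (a * (r - x)) ≤ G := by
        have := mul_le_mul_of_nonneg_right h2 (Real.exp_pos (a * (r - x))).le
        rwa [mul_assoc, ← Real.exp_add, neg_add_cancel, Real.exp_zero, mul_one] at this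
      refine le_trans (mul_le_mul_of_nonneg_left ?_ (by linarith)) h5
      linarith [Real.add_one_le_exp (a * (r - x))]
    have h6 : 1 - a * x ≤ G := by linarith [Real.add_one_le_exp (-(a * x))]
    have h7 : cdf μ x = 1 - G := by rw [hG]; ring
    have h8 : cdf μ r = 1 - Q := by rw [hQ]; ring
    rw [h7, h8]
    have hQp : 0 < Q := by rw [hQ]; linarith
    -- Adding `x` times `h4` and `Q (r - x)` times `h6` cancels the terms containing `a` and leaves
    -- `Q r ≤ G x + G Q (r - x)`, which is the claim.
    nlinarith [mul_le_mul_of_nonneg_left h4 hx0.le,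
      mul_le_mul_of_nonneg_left h6 (mul_nonneg hQp.le (sub_nonneg.2 hxr))]
  · have h0 : cdf μ x = 0 := le_antisymm (not_lt.1 hF) (cdf_nonneg x)
    rw [h0, zero_mul, zero_mul, sub_zero, one_mul]
    exact mul_nonneg (cdf_nonneg r) hx

/-! ### The second highest draw and its integrals in closed form. -/

/-- The probability that the second highest of `n` independent draws exceeds a point at which
their common cumulative distribution function is `u`. -/
def secondSurvival (n : ℕ) (u : ℝ) : ℝ := 1 - u ^ n - n * u ^ (n - 1) * (1 - u)

lemma hasDerivAt_secondSurvival (n : ℕ) (u : ℝ) :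
    HasDerivAt (secondSurvival n) (-(n * ((n - 1 : ℕ) * u ^ (n - 1 - 1)) * (1 - u))) u := by
  have h1 := ((hasDerivAt_pow n u).const_sub 1).sub
    (((hasDerivAt_pow (n - 1) u).const_mul (n : ℝ)).mul ((hasDerivAt_id u).const_sub 1))
  refine h1.congr_deriv ?_
  simp only [id]
  ring

lemma continuous_secondSurvival (n : ℕ) : Continuous (secondSurvival n) := by
  unfold secondSurvival
  fun_prop

lemma secondSurvival_antitoneOn (n : ℕ) : AntitoneOn (secondSurvival n) (Icc 0 1) := by
  refine antitoneOn_of_deriv_nonpos (convex_Icc 0 1) (continuous_secondSurvival n).continuousOn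
    (fun x _ => (hasDerivAt_secondSurvival n x).differentiableAt.differentiableWithinAt) ?_
  intro x hx
  rw [interior_Icc] at hx
  rw [(hasDerivAt_secondSurvival n x).deriv]
  have h0 := hx.1.le
  have h1 : 0 ≤ 1 - x := by linarith [hx.2]
  have : 0 ≤ (n : ℝ) * ((n - 1 : ℕ) * x ^ (n - 1 - 1)) * (1 - x) := by positivity
  linarith

lemma secondSurvival_one (n : ℕ) : secondSurvival n 1 = 0 := by simp [secondSurvival]

lemma secondSurvival_nonneg (n : ℕ) {u : ℝ} (h0 : 0 ≤ u) (h1 : u ≤ 1) :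
    0 ≤ secondSurvival n u := by
  rw [← secondSurvival_one n]
  exact secondSurvival_antitoneOn n ⟨h0, h1⟩ ⟨zero_le_one, le_rfl⟩ h1

lemma secondSurvival_le (n : ℕ) {u : ℝ} (h0 : 0 ≤ u) (h1 : u ≤ 1) :
    secondSurvival n u ≤ n * (1 - u) := by
  have h2 : 1 - u ^ n ≤ n * (1 - u) := by
    have := one_add_mul_le_pow (a := u - 1) (by linarith) n
    rw [add_sub_cancel] at this
    linarith
  have h3 : 0 ≤ n * u ^ (n - 1) * (1 - u) := by
    have : 0 ≤ 1 - u := by linarith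
    positivity
  rw [secondSurvival]
  linarith

/-- The integral of `(1 - (1 - z) ^ n) / z` over `[0, q]`, in closed form. -/
def harmonicSum (n : ℕ) (q : ℝ) : ℝ := ∑ k ∈ Finset.range n, (1 - (1 - q) ^ (k + 1)) / (k + 1)

lemma hasDerivAt_harmonicSum (n : ℕ) (q : ℝ) :
    HasDerivAt (harmonicSum n) (∑ k ∈ Finset.range n, (1 - q) ^ k) q := by
  unfold harmonicSum
  refine HasDerivAt.fun_sum fun k _ => ?_
  have h1 := ((((hasDerivAt_id q).const_sub 1).pow (k + 1)).const_sub 1).div_const ((k : ℝ) + 1)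
  refine h1.congr_deriv ?_
  have : (k : ℝ) + 1 ≠ 0 := by positivity
  simp only [id, Nat.add_sub_cancel]
  push_cast
  field_simp

lemma mul_geom_sum_one_sub (n : ℕ) (q : ℝ) :
    q * ∑ k ∈ Finset.range n, (1 - q) ^ k = 1 - (1 - q) ^ n := by
  have := mul_neg_geom_sum (1 - q) n
  rwa [sub_sub_cancel] at this

lemma harmonicSum_zero (n : ℕ) : harmonicSum n 0 = 0 := by simp [harmonicSum]

lemma harmonicSum_one (n : ℕ) : harmonicSum n 1 = harmonic n := by
  simp [harmonicSum, harmonic]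

lemma integral_eq_harmonicSum (n : ℕ) (q : ℝ) :
    ∫ z in (0 : ℝ)..q, (1 - (1 - z) ^ n) / z = harmonicSum n q := by
  have h1 : ∫ z in (0 : ℝ)..q, (1 - (1 - z) ^ n) / z =
      ∫ z in (0 : ℝ)..q, ∑ k ∈ Finset.range n, (1 - z) ^ k := by
    refine intervalIntegral.integral_congr_ae ?_
    -- At `z = 0` the quotient is `0` by convention whereas the sum equals `n`.
    have : ∀ᵐ z : ℝ, z ≠ 0 := by
      rw [ae_iff]; simp
    filter_upwards [this] with z hz _
    rw [← mul_geom_sum_one_sub]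
    field_simp
  rw [h1, intervalIntegral.integral_eq_sub_of_hasDerivAt
    (fun x _ => hasDerivAt_harmonicSum n x), harmonicSum_zero, sub_zero]
  exact Continuous.intervalIntegrable (by fun_prop) _ _

/-- The closed form of the integral of `secondSurvival n (1 - z) / z` over `[0, q]`. -/
def secondSum (n : ℕ) (q : ℝ) : ℝ := harmonicSum n q - (1 - (1 - q) ^ n)

lemma hasDerivAt_secondSum (n : ℕ) (q : ℝ) :
    HasDerivAt (secondSum n) (∑ k ∈ Finset.range n, (1 - q) ^ k - n * (1 - q) ^ (n - 1)) q := by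
  have h1 := (hasDerivAt_harmonicSum n q).sub
    ((((hasDerivAt_id q).const_sub 1).pow n).const_sub 1)
  refine h1.congr_deriv ?_
  simp

/-- Substitute `E = q exp (-(x - x₀) / s)`: then `dE = -(E / s) dx`, and `E` times the derivative of
`secondSum n` at `E` is `secondSurvival n (1 - E)`. So `-s * secondSum n E` is an antiderivative,
and it vanishes at infinity. -/
lemma integral_secondSurvival_exp (n : ℕ) {x₀ s q : ℝ} (hs : 0 < s) (hq0 : 0 ≤ q) (hq1 : q ≤ 1) :
    IntegrableOn (fun x => secondSurvival n (1 - q * Real.exp (-(x - x₀) / s))) (Ioi x₀) ∧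
    ∫ x in Ioi x₀, secondSurvival n (1 - q * Real.exp (-(x - x₀) / s)) = s * secondSum n q := by
  have hderiv : ∀ x ∈ Ici x₀, HasDerivAt (fun x => -s * secondSum n (q * Real.exp (-(x - x₀) / s)))
      (secondSurvival n (1 - q * Real.exp (-(x - x₀) / s))) x := by
    intro x _
    set E := q * Real.exp (-(x - x₀) / s) with hE
    have h1 : HasDerivAt (fun x => q * Real.exp (-(x - x₀) / s)) (-(E / s)) x := by
      have h2 : HasDerivAt (fun x => -(x - x₀) / s) (-1 / s) x :=
        (((hasDerivAt_id x).sub_const x₀).neg).div_const s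
      refine (h2.exp.const_mul q).congr_deriv ?_
      rw [hE]; ring
    have h3 := ((hasDerivAt_secondSum n E).comp x h1).const_mul (-s)
    refine h3.congr_deriv ?_
    have h4 := mul_geom_sum_one_sub n E
    rw [secondSurvival]
    field_simp
    linear_combination h4
  have hpos : ∀ x ∈ Ioi x₀, 0 ≤ secondSurvival n (1 - q * Real.exp (-(x - x₀) / s)) := by
    intro x hx
    have h1 : Real.exp (-(x - x₀) / s) ≤ 1 := by
      rw [Real.exp_le_one_iff]
      exact div_nonpos_of_nonpos_of_nonneg (by linarith [mem_Ioi.1 hx]) hs.le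
    have h2 := Real.exp_pos (-(x - x₀) / s)
    exact secondSurvival_nonneg n (by nlinarith) (by nlinarith)
  have hlim : Tendsto (fun x => -s * secondSum n (q * Real.exp (-(x - x₀) / s))) atTop (𝓝 0) := by
    have h1 : Tendsto (fun x => q * Real.exp (-(x - x₀) / s)) atTop (𝓝 0) := by
      rw [← mul_zero q]
      refine (Real.tendsto_exp_atBot.comp ?_).const_mul q
      refine Tendsto.atBot_div_const hs ?_
      exact tendsto_neg_atTop_atBot.comp (tendsto_atTop_add_const_right _ _ tendsto_id)
    have h2 : Tendsto (secondSum n) (𝓝 0) (𝓝 0) := by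
      have := (hasDerivAt_secondSum n 0).continuousAt.tendsto
      rwa [show secondSum n 0 = 0 by simp [secondSum, harmonicSum_zero]] at this
    simpa using (h2.comp h1).const_mul (-s)
  refine ⟨integrableOn_Ioi_deriv_of_nonneg' hderiv hpos hlim, ?_⟩
  rw [integral_Ioi_of_hasDerivAt_of_nonneg' hderiv hpos hlim]
  simp

/-! ### The law of the maximum. -/

/-- The law of the highest of `n` independent draws from `μ`. -/
def maxLaw (μ : Measure ℝ) (n : ℕ) : Measure ℝ := (iidLaw μ n).map fun v => ⨆ i, v i

lemma measurable_iSup_coord (n : ℕ) : Measurable fun v : Fin n → ℝ => ⨆ i, v i :=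
  Measurable.iSup fun i => measurable_pi_apply i

lemma maxLaw_Iic [IsProbabilityMeasure μ] {n : ℕ} (hn : n ≠ 0) (x : ℝ) :
    maxLaw μ n (Iic x) = μ (Iic x) ^ n := by
  have : Nonempty (Fin n) := ⟨⟨0, Nat.pos_of_ne_zero hn⟩⟩
  rw [maxLaw, Measure.map_apply (measurable_iSup_coord n) measurableSet_Iic]
  have : (fun v : Fin n → ℝ => ⨆ i, v i) ⁻¹' Iic x = Set.pi univ fun _ => Iic x := by
    ext v
    simp only [mem_preimage, mem_Iic, Set.mem_pi, mem_univ, true_imp_iff]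
    exact ciSup_le_iff (Set.finite_range v).bddAbove
  rw [this, iidLaw, Measure.pi_pi]
  simp

instance isProbabilityMeasure_iidLaw [IsProbabilityMeasure μ] (n : ℕ) :
    IsProbabilityMeasure (iidLaw μ n) := by
  unfold iidLaw
  infer_instance

instance isProbabilityMeasure_maxLaw [IsProbabilityMeasure μ] (n : ℕ) :
    IsProbabilityMeasure (maxLaw μ n) :=
  Measure.isProbabilityMeasure_map (measurable_iSup_coord n).aemeasurable

lemma maxLaw_real_Ioi [IsProbabilityMeasure μ] {n : ℕ} (hn : n ≠ 0) (x : ℝ) :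
    (maxLaw μ n).real (Ioi x) = 1 - cdf μ x ^ n := by
  rw [real_Ioi_eq, cdf, Measure.real, maxLaw_Iic hn, ENNReal.toReal_pow]
  rfl

/-- This is `∫ (k + 1) F^k dF = F^(k+1)` without any differentiation. In the induction one factor of
`F(y)^(k+1)` is written as an integral over `z < y`. After exchanging the integrals, the hypothesis
evaluates the inner one as a difference `F(x)^(k+1) - F(z)^(k+1)`, up to the factor `k + 1`, and the
integral sought reappears on the other side. -/
lemma lintegral_measure_Iic_pow [IsProbabilityMeasure μ] [NullSingletonClass μ] (k : ℕ) (x : ℝ) :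
    (k + 1) * ∫⁻ y in Iic x, μ (Iic y) ^ k ∂μ = μ (Iic x) ^ (k + 1) := by
  have hmono : Monotone fun y => μ (Iic y) := fun a b hab => measure_mono (Iic_subset_Iic.2 hab)
  have hmeas : Measurable fun y => μ (Iic y) := hmono.measurable
  induction k generalizing x with
  | zero => simp
  | succ k ih =>
    have h1 : ∫⁻ y in Iic x, μ (Iic y) ^ (k + 1) ∂μ =
        ∫⁻ z in Iic x, ∫⁻ y in Ioc z x, μ (Iic y) ^ k ∂μ ∂μ := by
      calc ∫⁻ y in Iic x, μ (Iic y) ^ (k + 1) ∂μ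
          = ∫⁻ y in Iic x, ∫⁻ z in Iic x, (Iio y).indicator (fun _ => μ (Iic y) ^ k) z ∂μ ∂μ := by
            refine setLIntegral_congr_fun measurableSet_Iic fun y hy => ?_
            rw [lintegral_indicator measurableSet_Iio, Measure.restrict_restrict measurableSet_Iio,
              inter_eq_left.2 (show Iio y ⊆ Iic x from fun z hz =>
                (le_of_lt (mem_Iio.1 hz)).trans (mem_Iic.1 hy)),
              setLIntegral_const, measure_congr Iio_ae_eq_Iic, pow_succ]
        _ = ∫⁻ z in Iic x, ∫⁻ y in Iic x, (Iio y).indicator (fun _ => μ (Iic y) ^ k) z ∂μ ∂μ := by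
            refine lintegral_lintegral_swap ?_
            have : (Function.uncurry fun y z => (Iio y).indicator (fun _ => μ (Iic y) ^ k) z) =
                {p : ℝ × ℝ | p.2 < p.1}.indicator fun p => μ (Iic p.1) ^ k := by
              ext ⟨y, z⟩
              simp [Function.uncurry, indicator]
            rw [this]
            exact (((hmeas.comp measurable_fst).pow_const k).indicator
              (measurableSet_lt measurable_snd measurable_fst)).aemeasurable
        _ = ∫⁻ z in Iic x, ∫⁻ y in Ioc z x, μ (Iic y) ^ k ∂μ ∂μ := by
            refine lintegral_congr fun z => ?_
            rw [← Ioi_inter_Iic, ← Measure.restrict_restrict measurableSet_Ioi,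
              ← lintegral_indicator measurableSet_Ioi]
            rfl
    have h2 : ∀ z ∈ Iic x, (k + 1) * ∫⁻ y in Ioc z x, μ (Iic y) ^ k ∂μ + μ (Iic z) ^ (k + 1) =
        μ (Iic x) ^ (k + 1) := by
      intro z hz
      rw [← ih z, ← ih x, ← Iic_union_Ioc_eq_Iic (mem_Iic.1 hz),
        lintegral_union measurableSet_Ioc (Iic_disjoint_Ioc le_rfl)]
      ring
    have h3 : (k + 1) * ∫⁻ y in Iic x, μ (Iic y) ^ (k + 1) ∂μ +
        ∫⁻ y in Iic x, μ (Iic y) ^ (k + 1) ∂μ = μ (Iic x) ^ (k + 1 + 1) := by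
      conv_lhs => enter [1]; rw [h1]
      rw [← lintegral_const_mul' _ _ (by finiteness),
        ← lintegral_add_right _ (hmeas.pow_const _), setLIntegral_congr_fun measurableSet_Iic h2,
        setLIntegral_const, pow_succ _ (k + 1)]
    rw [← h3]
    push_cast
    ring

/-- The density of the law of the highest draw. -/
lemma maxLaw_eq_withDensity [IsProbabilityMeasure μ] [NullSingletonClass μ] {n : ℕ} (hn : n ≠ 0) :
    maxLaw μ n = μ.withDensity fun x => ENNReal.ofReal (n * cdf μ x ^ (n - 1)) := by
  refine Measure.ext_of_Iic _ _ fun x => ?_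
  obtain ⟨k, rfl⟩ := Nat.exists_eq_succ_of_ne_zero hn
  rw [maxLaw_Iic hn, withDensity_apply _ measurableSet_Iic, ← lintegral_measure_Iic_pow,
    ← lintegral_const_mul' _ _ (by finiteness)]
  refine lintegral_congr fun y => ?_
  rw [ENNReal.ofReal_mul (Nat.cast_nonneg _), ENNReal.ofReal_pow (cdf_nonneg y), cdf,
    ofReal_measureReal, ENNReal.ofReal_natCast]
  simp

/-- The layer cake formula, with the levels translated by `r`. -/
lemma integral_max_sub_eq {ν : Measure ℝ} [IsProbabilityMeasure ν] {r : ℝ}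
    (hν : IntegrableOn (fun t => ν.real (Ioi t)) (Ioi r)) :
    Integrable (fun x => max (x - r) 0) ν ∧
      ∫ x, max (x - r) 0 ∂ν = ∫ t in Ioi r, ν.real (Ioi t) := by
  have hnn : 0 ≤ᵐ[ν] fun x => max (x - r) 0 := ae_of_all _ fun x => le_max_right _ _
  have hset : ∀ t ∈ Ioi (0 : ℝ), {x : ℝ | t < max (x - r) 0} = Ioi (t + r) := by
    intro t ht
    ext x
    have ht' : 0 < t := ht
    simp only [mem_ofPred_eq, lt_max_iff, mem_Ioi, ht'.not_gt, or_false]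
    exact lt_sub_iff_add_lt
  have hmeas : Measurable fun x : ℝ => max (x - r) 0 := by fun_prop
  have hshiftmp := measurePreserving_add_right (volume : Measure ℝ) r
  have hemb := (MeasurableEquiv.addRight r).measurableEmbedding
  have hpre : (fun t => t + r) ⁻¹' Ioi r = Ioi (0 : ℝ) := by
    ext t; simp
  have hshift : IntegrableOn (fun t => ν.real (Ioi (t + r))) (Ioi 0) := by
    have := (hshiftmp.integrableOn_comp_preimage hemb (f := fun t => ν.real (Ioi t))
      (s := Ioi r)).2 hν
    rwa [hpre] at this
  have hint : Integrable (fun x => max (x - r) 0) ν := by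
    refine ⟨hmeas.aestronglyMeasurable, ?_⟩
    rw [hasFiniteIntegral_iff_ofReal hnn, lintegral_eq_lintegral_meas_lt ν hnn hmeas.aemeasurable]
    have h1 := hshift.2
    rw [hasFiniteIntegral_iff_ofReal (ae_of_all _ fun t => measureReal_nonneg)] at h1
    refine lt_of_eq_of_lt (setLIntegral_congr_fun measurableSet_Ioi fun t ht => ?_) h1
    simp only [hset t ht]
    rw [ofReal_measureReal]
  refine ⟨hint, ?_⟩
  rw [hint.integral_eq_integral_meas_lt hnn, setIntegral_congr_fun measurableSet_Ioi
    (g := fun t => ν.real (Ioi (t + r))) fun t ht => by simp only [hset t ht]]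
  have := hshiftmp.setIntegral_preimage_emb hemb (fun t => ν.real (Ioi t)) (Ioi r)
  rwa [hpre] at this

lemma integral_maxLaw [IsProbabilityMeasure μ] [NullSingletonClass μ] {n : ℕ} (hn : n ≠ 0)
    (g : ℝ → ℝ) : ∫ x, g x ∂(maxLaw μ n) = ∫ x, n * cdf μ x ^ (n - 1) * g x ∂μ := by
  rw [maxLaw_eq_withDensity hn, integral_withDensity_eq_integral_toReal_smul₀]
  · refine integral_congr_ae (ae_of_all _ fun x => ?_)
    have : 0 ≤ n * cdf μ x ^ (n - 1) := by
      have := cdf_nonneg (μ := μ) x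
      positivity
    simp only [smul_eq_mul, ENNReal.toReal_ofReal this]
  · have := (cdf_mono (μ := μ)).measurable
    fun_prop
  · exact ae_of_all _ fun x => ENNReal.ofReal_lt_top

lemma integrable_maxLaw [IsProbabilityMeasure μ] [NullSingletonClass μ] {n : ℕ} (hn : n ≠ 0)
    {g : ℝ → ℝ} (hg : Integrable g (maxLaw μ n)) :
    Integrable (fun x => n * cdf μ x ^ (n - 1) * g x) μ := by
  have hmeas := (cdf_mono (μ := μ)).measurable
  rw [maxLaw_eq_withDensity hn, integrable_withDensity_iff_integrable_smul' (by fun_prop)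
    (ae_of_all _ fun x => ENNReal.ofReal_lt_top)] at hg
  refine hg.congr (ae_of_all _ fun x => ?_)
  have : 0 ≤ n * cdf μ x ^ (n - 1) := by
    have := cdf_nonneg (μ := μ) x
    positivity
  simp only [smul_eq_mul, ENNReal.toReal_ofReal this]

/-! ### Myerson's revenue and the second price auction with reserve. -/

namespace IsMHR

variable (h : IsMHR μ f)
include h

lemma measurable_cdf : Measurable (cdf μ) := h.continuous_cdf.measurable

lemma measurable_invHazardReal : Measurable (invHazardReal μ f) :=
  (measurable_const.sub h.measurable_cdf).div h.measurable_pdf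

lemma pdf_mul_invHazardReal_ae (g : ℝ → ℝ) :
    (fun x => (ENNReal.ofReal (f x)).toReal • (g x * invHazardReal μ f x)) =ᵐ[volume]
      (core μ).indicator fun x => g x * (1 - cdf μ x) := by
  filter_upwards [h.ae_mem_core_or_pdf_eq_zero] with x hx
  rw [ENNReal.toReal_ofReal (h.pdf_nonneg x), smul_eq_mul]
  by_cases hc : x ∈ core μ
  · rw [indicator_of_mem hc, invHazardReal]
    have := (h.pdf_pos hc).ne'
    field_simp
  · rw [indicator_of_notMem hc, hx.resolve_left hc, zero_mul]

/-- The density cancels the denominator of `m`, which removes `f` from every later formula. -/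
lemma integral_mul_invHazardReal (g : ℝ → ℝ) :
    ∫ x, g x * invHazardReal μ f x ∂μ = ∫ x in core μ, g x * (1 - cdf μ x) := by
  have h1 : ∀ k : ℝ → ℝ, ∫ x, k x ∂μ = ∫ x, (ENNReal.ofReal (f x)).toReal • k x := by
    intro k
    conv_lhs => rw [h.eq_withDensity]
    rw [integral_withDensity_eq_integral_toReal_smul h.measurable_pdf.ennreal_ofReal
      (ae_of_all _ fun x => ENNReal.ofReal_lt_top)]
  rw [h1, ← integral_indicator h.measurableSet_core]
  exact integral_congr_ae (h.pdf_mul_invHazardReal_ae g)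

lemma integrable_mul_invHazardReal {g : ℝ → ℝ}
    (hg : IntegrableOn (fun x => g x * (1 - cdf μ x)) (core μ)) :
    Integrable (fun x => g x * invHazardReal μ f x) μ := by
  have h1 := (integrable_indicator_iff h.measurableSet_core).2 hg
  have h2 : Integrable (fun x => g x * invHazardReal μ f x)
      (volume.withDensity fun x => ENNReal.ofReal (f x)) := by
    rw [integrable_withDensity_iff_integrable_smul' h.measurable_pdf.ennreal_ofReal
      (ae_of_all _ fun x => ENNReal.ofReal_lt_top)]
    exact h1.congr (h.pdf_mul_invHazardReal_ae g).symm
  rwa [← h.eq_withDensity] at h2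

lemma integrableOn_survival : IntegrableOn (fun x => 1 - cdf μ x) (Ioi 0) := by
  have := h.isProbabilityMeasure
  obtain ⟨r, hr⟩ := h.exists_isReserve
  have h1 := (exp_neg_integrableOn_Ioi 0 (inv_pos.2 hr.pos)).const_mul
    ((1 - cdf μ r) * Real.exp 1)
  refine h1.mono' (measurable_const.sub h.measurable_cdf).aestronglyMeasurable
    (ae_of_all _ fun x => ?_)
  rw [Real.norm_of_nonneg (by linarith [cdf_le_one (μ := μ) x])]
  refine (hr.survival_le x).trans (le_of_eq ?_)
  rw [mul_assoc, ← Real.exp_add]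
  congr 2
  have := hr.pos.ne'
  field_simp
  ring

lemma core_subset_Ioi : core μ ⊆ Ioi 0 := fun _ hx => h.pos_of_mem_core hx

lemma integrableOn_of_abs_le {g : ℝ → ℝ} (hg : Measurable g) {C : ℝ}
    (hgC : ∀ x, |g x| ≤ C * (1 - cdf μ x)) : IntegrableOn g (Ioi 0) :=
  (h.integrableOn_survival.const_mul C).mono' hg.aestronglyMeasurable (ae_of_all _ hgC)

lemma integrable_invHazardReal : Integrable (invHazardReal μ f) μ := by
  have := h.integrable_mul_invHazardReal (g := fun _ => 1)
    (by simpa using h.integrableOn_survival.mono_set h.core_subset_Ioi)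
  simpa using this

lemma integrable_id : Integrable (fun x : ℝ => x) μ := by
  have := h.isProbabilityMeasure
  have h1 := (integral_max_sub_eq (ν := μ) (r := 0)
    (by simpa only [real_Ioi_eq] using h.integrableOn_survival)).1
  refine h1.congr ?_
  filter_upwards [h.ae_mem_core] with x hx
  rw [sub_zero, max_eq_left (h.pos_of_mem_core hx).le]

lemma integrableOn_one_sub_cdf_pow (n : ℕ) :
    IntegrableOn (fun x => 1 - cdf μ x ^ n) (Ioi 0) := by
  have := h.isProbabilityMeasure
  refine h.integrableOn_of_abs_le (C := n)
    (measurable_const.sub (h.measurable_cdf.pow_const n)) fun x => ?_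
  have h1 := cdf_le_one (μ := μ) x
  have h0 := cdf_nonneg (μ := μ) x
  rw [abs_of_nonneg (by linarith [pow_le_one₀ h0 h1 (n := n)])]
  have := one_add_mul_le_pow (a := cdf μ x - 1) (by linarith) n
  rw [add_sub_cancel] at this
  linarith

lemma integrableOn_secondSurvival (n : ℕ) :
    IntegrableOn (fun x => secondSurvival n (cdf μ x)) (Ioi 0) := by
  have := h.isProbabilityMeasure
  refine h.integrableOn_of_abs_le (C := n)
    ((continuous_secondSurvival n).measurable.comp h.measurable_cdf) fun x => ?_
  rw [abs_of_nonneg (secondSurvival_nonneg n (cdf_nonneg x) (cdf_le_one x))]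
  exact secondSurvival_le n (cdf_nonneg x) (cdf_le_one x)

lemma measurable_virtualValue : Measurable (virtualValue μ f) :=
  measurable_id.sub h.measurable_invHazardReal

/-- The optimal revenue is at most that of the second price auction with the optimal reserve. -/
lemma myerson_le {r : ℝ} (hr : IsReserve μ f r) {n : ℕ} (hn : 2 ≤ n) :
    myerson μ f n ≤ ENNReal.ofReal
      (r * (1 - cdf μ r ^ n) + ∫ x in Ioi r, secondSurvival n (cdf μ x)) := by
  have := h.isProbabilityMeasure
  have := h.noAtoms
  have hn0 : n ≠ 0 := by omega
  set w : ℝ → ℝ := fun x => n * cdf μ x ^ (n - 1) with hw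
  have hw0 : ∀ x, 0 ≤ w x := fun x => by
    have := cdf_nonneg (μ := μ) x
    positivity
  have hwm : Measurable w := (h.measurable_cdf.pow_const _).const_mul _
  have hIoi : Ioi r ⊆ Ioi (0 : ℝ) := Ioi_subset_Ioi hr.pos.le
  -- With `w` the density of the maximum relative to `μ`, `w * max 0 φ` splits as `g₁ + g₂ - g₃`.
  -- The integrals are `∫_r^∞ (1 - F^n)`, `r (1 - F(r)^n)` and `∫_r^∞ n F^(n-1) (1 - F)`; the first
  -- minus the third is the integral of `secondSurvival`.
  set g₁ : ℝ → ℝ := fun x => w x * max (x - r) 0 with hg₁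
  set g₂ : ℝ → ℝ := fun x => w x * (Ioi r).indicator (fun _ => r) x with hg₂
  set g₃ : ℝ → ℝ := fun x => (Ioi r).indicator w x * invHazardReal μ f x with hg₃
  have hpow : IntegrableOn (fun t => (maxLaw μ n).real (Ioi t)) (Ioi r) := by
    simpa only [maxLaw_real_Ioi hn0] using (h.integrableOn_one_sub_cdf_pow n).mono_set hIoi
  have hwsurv : IntegrableOn (fun x => w x * (1 - cdf μ x)) (Ioi r) := by
    refine IntegrableOn.mono_set ?_ hIoi
    refine h.integrableOn_of_abs_le (C := n) (hwm.mul (measurable_const.sub h.measurable_cdf))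
      fun x => ?_
    have h1 := cdf_le_one (μ := μ) x
    have h0 := cdf_nonneg (μ := μ) x
    have h2 : 0 ≤ 1 - cdf μ x := by linarith
    rw [abs_of_nonneg (mul_nonneg (hw0 x) h2)]
    refine mul_le_mul_of_nonneg_right ?_ h2
    exact mul_le_of_le_one_right (Nat.cast_nonneg n) (pow_le_one₀ h0 h1)
  have hi₁ : Integrable g₁ μ := integrable_maxLaw hn0 (integral_max_sub_eq hpow).1
  have hi₂ : Integrable g₂ μ :=
    integrable_maxLaw hn0 ((integrable_const r).indicator measurableSet_Ioi)
  have hind : ∀ x, (Ioi r).indicator w x * (1 - cdf μ x) =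
      (Ioi r).indicator (fun x => w x * (1 - cdf μ x)) x := by
    intro x
    by_cases hx : x ∈ Ioi r <;> simp [hx]
  have hi₃ : Integrable g₃ μ := by
    refine h.integrable_mul_invHazardReal ?_
    simp only [hind]
    exact ((integrable_indicator_iff measurableSet_Ioi).2 hwsurv).integrableOn
  have hi₁₂ : Integrable (fun x => g₁ x + g₂ x) μ := hi₁.add hi₂
  have hi : Integrable (fun x => g₁ x + g₂ x - g₃ x) μ := hi₁₂.sub hi₃
  have he₁ : ∫ x, g₁ x ∂μ = ∫ x in Ioi r, (1 - cdf μ x ^ n) := by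
    rw [hg₁, ← integral_maxLaw hn0, (integral_max_sub_eq hpow).2]
    simp only [maxLaw_real_Ioi hn0]
  have he₂ : ∫ x, g₂ x ∂μ = r * (1 - cdf μ r ^ n) := by
    rw [hg₂, ← integral_maxLaw hn0, integral_indicator measurableSet_Ioi, setIntegral_const,
      maxLaw_real_Ioi hn0, smul_eq_mul, mul_comm]
  have he₃ : ∫ x, g₃ x ∂μ = ∫ x in Ioi r, w x * (1 - cdf μ x) := by
    rw [hg₃, h.integral_mul_invHazardReal]
    simp only [hind]
    rw [setIntegral_eq_integral_of_forall_compl_eq_zero, integral_indicator measurableSet_Ioi]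
    intro x hx
    by_cases hxr : x ∈ Ioi r
    · rw [indicator_of_mem hxr]
      by_cases hF : 0 < cdf μ x
      · have : cdf μ x = 1 := le_antisymm (cdf_le_one x) (not_lt.1 fun hc => hx ⟨hF, hc⟩)
        rw [this, sub_self, mul_zero]
      -- Here `n ≥ 2` matters: the weight contains the positive power `F^(n-1)`.
      · have : cdf μ x = 0 := le_antisymm (not_lt.1 hF) (cdf_nonneg x)
        simp [hw, this, zero_pow (show n - 1 ≠ 0 by omega)]
    · rw [indicator_of_notMem hxr]
  have hsum : ∫ x, (g₁ x + g₂ x - g₃ x) ∂μ =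
      r * (1 - cdf μ r ^ n) + ∫ x in Ioi r, secondSurvival n (cdf μ x) := by
    rw [integral_sub hi₁₂ hi₃, integral_add hi₁ hi₂, he₁, he₂, he₃, add_comm, add_sub_assoc,
      ← integral_sub ((h.integrableOn_one_sub_cdf_pow n).mono_set hIoi) hwsurv]
    rfl
  have hpoint : ∀ᵐ x ∂μ, w x * max 0 (virtualValue μ f x) = g₁ x + g₂ x - g₃ x := by
    have hne : ∀ᵐ x ∂μ, x ≠ r := by
      rw [ae_iff]; simp
    filter_upwards [h.ae_mem_core, hne] with x hx hxr
    have hv : virtualValue μ f x = x - invHazardReal μ f x := rfl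
    rcases lt_or_gt_of_ne hxr with hlt | hgt
    · have h1 := hr.lt_invHazardReal x hx hlt
      rw [hv, max_eq_left (by linarith)]
      have : x ∉ Ioi r := by simpa using hlt.le
      simp [hg₁, hg₂, hg₃, this, hlt.le]
    · have h1 := hr.invHazardReal_le x hx hgt
      rw [hv, max_eq_right (by linarith)]
      have : x ∈ Ioi r := hgt
      simp only [hg₁, hg₂, hg₃, indicator_of_mem this]
      rw [max_eq_left (by linarith)]
      ring
  rw [← hsum, myerson]
  have hm : Measurable fun x => ENNReal.ofReal (max 0 (virtualValue μ f x)) :=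
    (measurable_const.max h.measurable_virtualValue).ennreal_ofReal
  rw [← lintegral_map (μ := iidLaw μ n) hm (measurable_iSup_coord n)]
  change ∫⁻ x, _ ∂(maxLaw μ n) ≤ _
  rw [maxLaw_eq_withDensity hn0, lintegral_withDensity_eq_lintegral_mul _ (by
    have := h.measurable_cdf
    fun_prop) hm]
  rw [ofReal_integral_eq_lintegral_ofReal hi
    (hpoint.mono fun x hx => ?_)]
  · refine lintegral_mono_ae (hpoint.mono fun x hx => ?_)
    simp only [Pi.mul_apply]
    rw [← ENNReal.ofReal_mul (hw0 x)]
    exact ENNReal.ofReal_le_ofReal hx.le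
  · simp only [Pi.zero_apply]
    rw [← hx]
    exact mul_nonneg (hw0 x) (le_max_left _ _)

end IsMHR

/-! ### The two estimates of the optimal revenue. -/

lemma three_half_le_harmonic {n : ℕ} (hn : 2 ≤ n) : (3 / 2 : ℝ) ≤ harmonic n := by
  induction n, hn using Nat.le_induction with
  | base => norm_num [harmonic, Finset.sum_range_succ]
  | succ n hn ih =>
    rw [harmonic_succ]
    push_cast
    have : (0 : ℝ) ≤ ((n : ℝ) + 1)⁻¹ := by positivity
    linarith

lemma secondSum_one {n : ℕ} (hn : n ≠ 0) : secondSum n 1 = harmonic n - 1 := by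
  simp [secondSum, harmonicSum_one, hn]

lemma secondSurvival_le_one (n : ℕ) {u : ℝ} (h0 : 0 ≤ u) (h1 : u ≤ 1) :
    secondSurvival n u ≤ 1 := by
  have h2 : 0 ≤ 1 - u := by linarith
  have h3 : 0 ≤ u ^ n := by positivity
  have h4 : 0 ≤ n * u ^ (n - 1) * (1 - u) := by positivity
  rw [secondSurvival]
  linarith

/-- The mean of `secondSurvival n` along the triangular distribution. -/
lemma integral_secondSurvival_triangular {n : ℕ} (hn : 2 ≤ n) {c r : ℝ} (hc : 0 ≤ c)
    (hr : 0 ≤ r) :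
    IntervalIntegrable (fun x => secondSurvival n (x * c / (1 + x * c))) volume 0 r ∧
    ∫ x in (0 : ℝ)..r, secondSurvival n (x * c / (1 + x * c)) =
      r * (1 - (r * c / (1 + r * c)) ^ (n - 1)) := by
  have hpos : ∀ x ∈ uIcc 0 r, 0 < 1 + x * c := by
    intro x hx
    rw [uIcc_of_le hr] at hx
    have := mul_nonneg hx.1 hc
    linarith
  -- With `u / (1 - u) = c x` one has `x u' = u (1 - u)`, which makes `x (1 - u^(n-1))` an
  -- antiderivative.
  have hderiv : ∀ x ∈ uIcc 0 r, HasDerivAt (fun x => x * (1 - (x * c / (1 + x * c)) ^ (n - 1)))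
      (secondSurvival n (x * c / (1 + x * c))) x := by
    intro x hx
    have hx1 := (hpos x hx).ne'
    have h1 : HasDerivAt (fun x => x * c) c x := by simpa using (hasDerivAt_id x).mul_const c
    have h2 := h1.div (h1.const_add 1) hx1
    have h3 := (hasDerivAt_id x).mul ((h2.pow (n - 1)).const_sub 1)
    refine h3.congr_deriv ?_
    obtain ⟨m, rfl⟩ := Nat.exists_eq_add_of_le hn
    rw [show 2 + m - 1 = m + 1 by omega, show m + 1 - 1 = m by omega, secondSurvival,
      show 2 + m - 1 = m + 1 by omega]
    simp only [Pi.div_apply, id, Pi.pow_apply]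
    push_cast
    set u := x * c / (1 + x * c) with hu
    have h4 : x * ((c * (1 + x * c) - x * c * c) / (1 + x * c) ^ 2) = u * (1 - u) := by
      rw [hu]
      field_simp
    rw [show 2 + m = m + 1 + 1 by omega]
    linear_combination (-(m + 1) * u ^ m) * h4
  have hint : IntervalIntegrable (fun x => secondSurvival n (x * c / (1 + x * c))) volume 0 r := by
    refine ContinuousOn.intervalIntegrable fun x hx => ?_
    have hx1 := (hpos x hx).ne'
    have : ContinuousAt (fun x => x * c / (1 + x * c)) x := by fun_prop (disch := assumption)
    exact (((continuous_secondSurvival n).continuousAt).comp this).continuousWithinAt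
  refine ⟨hint, ?_⟩
  rw [intervalIntegral.integral_eq_sub_of_hasDerivAt hderiv hint]
  simp

namespace IsMHR

variable (h : IsMHR μ f)
include h

lemma setIntegral_secondSurvival_le {r s q : ℝ} (n : ℕ) (hr : 0 ≤ r) (hs : 0 < s)
    (hq0 : 0 ≤ q) (hq1 : q ≤ 1)
    (hle : ∀ x, 1 - cdf μ x ≤ q * Real.exp (-(x - r) / s)) :
    ∫ x in Ioi r, secondSurvival n (cdf μ x) ≤ s * secondSum n q := by
  have := h.isProbabilityMeasure
  obtain ⟨hi, he⟩ := integral_secondSurvival_exp n (x₀ := r) hs hq0 hq1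
  rw [← he]
  refine setIntegral_mono_on ((h.integrableOn_secondSurvival n).mono_set (Ioi_subset_Ioi hr)) hi
    measurableSet_Ioi fun x hx => ?_
  have h1 : Real.exp (-(x - r) / s) ≤ 1 := by
    rw [Real.exp_le_one_iff]
    exact div_nonpos_of_nonpos_of_nonneg (by linarith [mem_Ioi.1 hx]) hs.le
  have h2 := Real.exp_pos (-(x - r) / s)
  exact secondSurvival_antitoneOn n ⟨by nlinarith, by nlinarith⟩ ⟨cdf_nonneg x, cdf_le_one x⟩
    (by linarith [hle x])

/-- The mean of the second highest draw is at most the price that is exceeded with probability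
`exp (1 - H_n)`. -/
lemma integral_secondSurvival_le {n : ℕ} (hn : 2 ≤ n) {p : ℝ} (hp : p ∈ core μ)
    (hp' : 1 - cdf μ p = Real.exp (-(harmonic n : ℝ) + 1)) :
    ∫ x in Ioi 0, secondSurvival n (cdf μ x) ≤ p := by
  have := h.isProbabilityMeasure
  set s := invHazardReal μ f p with hs
  have hspos : 0 < s := h.invHazardReal_pos hp
  set t := (harmonic n : ℝ) - 1 with ht
  -- The tangent exponential at `p` reaches the value `1` at `x₀`. The second highest of `n` draws
  -- from this shifted exponential has mean `x₀ + s (H_n - 1)`, which is exactly `p`; this dictates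
  -- the choice of `p`.
  set x₀ := p - t * s with hx₀
  have hle : ∀ x, 1 - cdf μ x ≤ 1 * Real.exp (-(x - x₀) / s) := by
    intro x
    refine (h.survival_le_exp hp x).trans (le_of_eq ?_)
    rw [hp', ← Real.exp_add, one_mul, ← hs, hx₀, ht]
    congr 1
    field_simp
    ring
  have hx₀0 : 0 ≤ x₀ := by
    have := hle 0
    rw [h.cdf_eq_zero le_rfl, sub_zero, one_mul, Real.one_le_exp_iff, zero_sub, neg_neg] at this
    have := mul_nonneg this hspos.le
    rwa [div_mul_cancel₀ _ hspos.ne'] at this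
  have hint := h.integrableOn_secondSurvival n
  have h1 := h.setIntegral_secondSurvival_le n hx₀0 hspos zero_le_one le_rfl hle
  rw [secondSum_one (by omega)] at h1
  have h2 : ∫ x in Ioc 0 x₀, secondSurvival n (cdf μ x) ≤ x₀ := by
    have h3 := setIntegral_mono_on (s := Ioc 0 x₀) (g := fun _ => (1 : ℝ))
      (hint.mono_set Ioc_subset_Ioi_self)
      (integrableOn_const (by simp)) measurableSet_Ioc
      fun x _ => secondSurvival_le_one n (cdf_nonneg x) (cdf_le_one (μ := μ) x)
    rw [setIntegral_const] at h3
    simpa [hx₀0] using h3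
  rw [← Ioc_union_Ioi_eq_Ioi hx₀0, setIntegral_union (Ioc_disjoint_Ioi le_rfl) measurableSet_Ioi
    (hint.mono_set Ioc_subset_Ioi_self) (hint.mono_set (Ioi_subset_Ioi hx₀0))]
  have : x₀ + s * t = p := by rw [hx₀]; ring
  linarith

lemma le_setIntegral_secondSurvival {n : ℕ} (hn : 2 ≤ n) {r : ℝ} (hr : 0 < r)
    (hr1 : cdf μ r < 1) :
    r * (1 - cdf μ r ^ (n - 1)) ≤ ∫ x in Ioc 0 r, secondSurvival n (cdf μ x) := by
  have := h.isProbabilityMeasure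
  set q := 1 - cdf μ r with hq
  have hq0 : 0 < q := by rw [hq]; linarith
  -- The slope for which the distribution with odds `c x` agrees with `F` at `r`; below `r` its
  -- distribution function dominates `F`.
  set c := cdf μ r / (q * r) with hc
  have hc0 : 0 ≤ c := div_nonneg (cdf_nonneg r) (by positivity)
  obtain ⟨hi, he⟩ := integral_secondSurvival_triangular hn hc0 hr.le
  have hu : r * c / (1 + r * c) = cdf μ r := by
    have h1 : r * c = cdf μ r / q := by rw [hc]; field_simp
    have h2 : 1 + cdf μ r / q = 1 / q := by rw [hq] at hq0 ⊢; field_simp; ring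
    rw [h1, h2]
    field_simp
  rw [hu, intervalIntegral.integral_of_le hr.le] at he
  rw [← he]
  refine setIntegral_mono_on ((intervalIntegrable_iff_integrableOn_Ioc_of_le hr.le).1 hi)
    ((h.integrableOn_secondSurvival n).mono_set Ioc_subset_Ioi_self) measurableSet_Ioc
    fun x hx => ?_
  have hxc : 0 ≤ x * c := mul_nonneg hx.1.le hc0
  have h1 := h.cdf_mul_le hx.1.le hx.2 hr1
  have h2 : cdf μ x ≤ x * c / (1 + x * c) := by
    rw [le_div_iff₀ (by linarith)]
    have h3 : cdf μ x ≤ (1 - cdf μ x) * (x * c) := by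
      rw [hc, show (1 - cdf μ x) * (x * (cdf μ r / (q * r))) =
        (1 - cdf μ x) * (cdf μ r * x) / (q * r) by ring, le_div_iff₀ (by positivity)]
      linarith
    linarith
  have h3 : x * c / (1 + x * c) ≤ 1 := by
    rw [div_le_one (by linarith)]
    linarith
  exact secondSurvival_antitoneOn n ⟨cdf_nonneg x, cdf_le_one x⟩ ⟨by positivity, h3⟩ h2

/-- The exponential bound at `r` gives `p (1 - F(p)) ≤ r`, since `p / r ≤ exp ((p - r) / r)`;
Bernoulli's inequality costs a factor `n`. -/
lemma optPrice_lt_top {n : ℕ} : optPrice μ n < ⊤ := by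
  have := h.isProbabilityMeasure
  obtain ⟨r, hr⟩ := h.exists_isReserve
  refine lt_of_le_of_lt (iSup₂_le fun p hp => ?_) (ENNReal.ofReal_lt_top (r := n * r))
  refine ENNReal.ofReal_le_ofReal ?_
  have hp0 : 0 ≤ p := h.support_subset hp
  have h1 := cdf_le_one (μ := μ) p
  have h0 := cdf_nonneg (μ := μ) p
  have h2 : 1 - cdf μ p ^ n ≤ n * (1 - cdf μ p) := by
    have := one_add_mul_le_pow (a := cdf μ p - 1) (by linarith) n
    rw [add_sub_cancel] at this
    linarith
  have hrp := hr.pos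
  have h3 : p * (1 - cdf μ p) ≤ r := by
    have h4 : 1 - cdf μ p ≤ Real.exp (-(p - r) / r) := by
      refine (hr.survival_le p).trans (mul_le_of_le_one_left (Real.exp_pos _).le ?_)
      linarith [cdf_nonneg (μ := μ) r]
    have h5 : p ≤ r * Real.exp ((p - r) / r) := by
      have := Real.add_one_le_exp ((p - r) / r)
      have h6 : p / r ≤ Real.exp ((p - r) / r) := by
        convert this using 1
        field_simp
        ring
      rwa [div_le_iff₀ hrp, mul_comm] at h6
    calc p * (1 - cdf μ p) ≤ r * Real.exp ((p - r) / r) * Real.exp (-(p - r) / r) :=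
          mul_le_mul h5 h4 (by linarith) (by positivity)
      _ = r := by rw [mul_assoc, ← Real.exp_add, neg_div, add_neg_cancel, Real.exp_zero, mul_one]
  calc priceRevenue μ n p = p * (1 - cdf μ p ^ n) := rfl
    _ ≤ p * (n * (1 - cdf μ p)) := mul_le_mul_of_nonneg_left h2 hp0
    _ = n * (p * (1 - cdf μ p)) := by ring
    _ ≤ n * r := mul_le_mul_of_nonneg_left h3 (Nat.cast_nonneg n)

lemma priceRevenue_le {n : ℕ} {p : ℝ} (hp : p ∈ μ.support) :
    p * (1 - cdf μ p ^ n) ≤ (optPrice μ n).toReal := by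
  rw [← ENNReal.ofReal_le_iff_le_toReal h.optPrice_lt_top.ne]
  exact le_iSup₂ (f := fun p _ => ENNReal.ofReal (priceRevenue μ n p)) p hp

lemma optPrice_pos {n : ℕ} (hn : n ≠ 0) : 0 < optPrice μ n := by
  obtain ⟨r, hr⟩ := h.exists_isReserve
  have h1 := hr.survival_pos h
  have h2 : cdf μ r ^ n < 1 := pow_lt_one₀ (cdf_nonneg r) (by linarith) hn
  have h3 := h.priceRevenue_le (n := n) hr.mem_support
  have h4 : 0 < r * (1 - cdf μ r ^ n) := mul_pos hr.pos (by linarith)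
  exact (ENNReal.toReal_pos_iff.1 (h4.trans_le h3)).1

lemma myerson_le_boundAt {n : ℕ} (hn : 2 ≤ n) :
    ∃ q ∈ Icc (1 / Real.exp 1) 1,
      myerson μ f n ≤ ENNReal.ofReal (boundAt n q) * optPrice μ n := by
  have := h.isProbabilityMeasure
  obtain ⟨r, hr⟩ := h.exists_isReserve
  set q := 1 - cdf μ r with hq
  have hF : cdf μ r = 1 - q := by rw [hq]; ring
  have hq0 : 0 < q := hr.survival_pos h
  have hq1 : q ≤ 1 := by linarith [cdf_nonneg (μ := μ) r]
  refine ⟨q, ⟨hr.exp_neg_one_le h, hq1⟩, ?_⟩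
  set P := (optPrice μ n).toReal with hP
  have hP0 : 0 ≤ P := ENNReal.toReal_nonneg
  rw [← ENNReal.ofReal_toReal h.optPrice_lt_top.ne, ← ENNReal.ofReal_mul' hP0]
  refine (h.myerson_le hr hn).trans (ENNReal.ofReal_le_ofReal ?_)
  have hrp := hr.pos
  have hDq : 0 < 1 - (1 - q) ^ n := by
    have := pow_lt_one₀ (show 0 ≤ 1 - q by linarith) (by linarith) (show n ≠ 0 by omega)
    linarith
  have hPr : r ≤ P / (1 - (1 - q) ^ n) := by
    rw [le_div_iff₀ hDq, ← hF]
    exact h.priceRevenue_le hr.mem_support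
  rw [boundAt, min_mul_of_nonneg _ _ hP0]
  refine le_min ?_ ?_
  -- First term: total mean of the second highest draw minus its part below `r`.
  · set e := Real.exp (-(harmonic n : ℝ) + 1) with he
    have he0 : 0 < e := Real.exp_pos _
    have he1 : e < 1 := by
      rw [he, Real.exp_lt_one_iff]
      linarith [three_half_le_harmonic hn]
    obtain ⟨p, hp, hp'⟩ := h.exists_cdf_eq (u := 1 - e) (by linarith) (by linarith)
    have h1 := h.integral_secondSurvival_le hn hp (by rw [hp']; ring)
    have hDe : 0 < 1 - (1 - e) ^ n := by
      have := pow_lt_one₀ (show 0 ≤ 1 - e by linarith) (by linarith) (show n ≠ 0 by omega)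
      linarith
    have hPp : p ≤ P / (1 - (1 - e) ^ n) := by
      rw [le_div_iff₀ hDe, ← hp']
      exact h.priceRevenue_le (h.core_subset_support hp)
    have hint := h.integrableOn_secondSurvival n
    rw [← Ioc_union_Ioi_eq_Ioi hrp.le, setIntegral_union (Ioc_disjoint_Ioi le_rfl)
      measurableSet_Ioi (hint.mono_set Ioc_subset_Ioi_self)
      (hint.mono_set (Ioi_subset_Ioi hrp.le))] at h1
    have h2 := h.le_setIntegral_secondSurvival hn hrp (by linarith)
    rw [hF] at h2 ⊢
    -- The reserve revenue exceeds the lower bound on `∫_0^r S` only by `r q (1 - q)^(n-1)`.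
    have h3 : r * (1 - (1 - q) ^ n) - r * (1 - (1 - q) ^ (n - 1)) =
        r * (q * (1 - q) ^ (n - 1)) := by
      have : (1 - q) ^ n = (1 - q) ^ (n - 1) * (1 - q) := by
        rw [← pow_succ, Nat.sub_add_cancel (by omega)]
      rw [this]
      ring
    have h4 : r * (q * (1 - q) ^ (n - 1)) ≤
        P / (1 - (1 - q) ^ n) * (q * (1 - q) ^ (n - 1)) := by
      refine mul_le_mul_of_nonneg_right hPr ?_
      have : 0 ≤ 1 - q := by linarith
      positivity
    have h5 : (1 / (1 - (1 - e) ^ n) + q * (1 - q) ^ (n - 1) / (1 - (1 - q) ^ n)) * P =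
        P / (1 - (1 - e) ^ n) + P / (1 - (1 - q) ^ n) * (q * (1 - q) ^ (n - 1)) := by ring
    rw [h5]
    linarith
  -- Second term: `r (1 - (1 - q)^n)` cancels the subtracted part of `secondSum`, leaving `r *
  -- harmonicSum n q`.
  · have h1 := h.setIntegral_secondSurvival_le n hrp.le hrp hq0.le hq1 hr.survival_le
    rw [secondSum] at h1
    rw [hF, integral_eq_harmonicSum]
    have h2 : r * harmonicSum n q ≤ P / (1 - (1 - q) ^ n) * harmonicSum n q := by
      refine mul_le_mul_of_nonneg_right hPr ?_
      unfold harmonicSum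
      refine Finset.sum_nonneg fun k _ => div_nonneg ?_ (by positivity)
      linarith [pow_le_one₀ (show 0 ≤ 1 - q by linarith) (by linarith : 1 - q ≤ 1) (n := k + 1)]
    have h3 : harmonicSum n q / (1 - (1 - q) ^ n) * P =
      P / (1 - (1 - q) ^ n) * harmonicSum n q := by ring
    rw [h3]
    linarith

end IsMHR

/-! ### Truthful auctions and the virtual surplus. -/

/-- Redrawing one coordinate preserves the joint law. -/
lemma measurePreserving_update [IsProbabilityMeasure μ] {n : ℕ} (i : Fin n) :
    MeasurePreserving (fun p : ℝ × (Fin n → ℝ) => Function.update p.2 i p.1)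
      (μ.prod (iidLaw μ n)) (iidLaw μ n) := by
  have hmeas : Measurable fun p : ℝ × (Fin n → ℝ) => Function.update p.2 i p.1 := by
    refine measurable_pi_iff.2 fun j => ?_
    by_cases hj : j = i
    · subst hj
      simpa using measurable_fst
    · simp only [Function.update_of_ne hj]
      exact (measurable_pi_apply j).comp measurable_snd
  refine ⟨hmeas, ?_⟩
  symm
  refine Measure.pi_eq fun s hs => ?_
  have hpre : (fun p : ℝ × (Fin n → ℝ) => Function.update p.2 i p.1) ⁻¹' Set.pi univ s =
      s i ×ˢ Set.pi univ (Function.update s i univ) := by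
    ext ⟨t, v⟩
    simp only [mem_preimage, Set.mem_pi, mem_univ, true_imp_iff, mem_prod]
    constructor
    · intro hv
      refine ⟨by simpa using hv i, fun j => ?_⟩
      by_cases hj : j = i
      · subst hj; simp
      · simpa [Function.update_of_ne hj] using hv j
    · rintro ⟨ht, hv⟩ j
      by_cases hj : j = i
      · subst hj; simpa using ht
      · simpa [Function.update_of_ne hj] using hv j
  rw [Measure.map_apply hmeas (MeasurableSet.univ_pi hs), hpre, Measure.prod_prod, iidLaw,
    Measure.pi_pi]
  have : (fun j => μ (Function.update s i univ j)) = Function.update (fun j => μ (s j)) i 1 := by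
    ext j
    by_cases hj : j = i
    · subst hj; simp
    · simp [Function.update_of_ne hj]
  rw [this, Finset.prod_update_of_mem (Finset.mem_univ i), one_mul,
    ← Finset.prod_eq_mul_prod_sdiff_singleton_of_mem (Finset.mem_univ i) (fun j => μ (s j))]

/-- A truthful single-bidder mechanism on an interval has utility at least the integral of its
allocation. -/
lemma integral_alloc_le_utility {x p : ℝ → ℝ} {a t : ℝ} (hat : a ≤ t)
    (hx0 : ∀ s ∈ Icc a t, 0 ≤ x s) (hx1 : ∀ s ∈ Icc a t, x s ≤ 1)
    (hu : ∀ s ∈ Icc a t, 0 ≤ s * x s - p s)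
    (htruth : ∀ s ∈ Icc a t, ∀ b ∈ Icc a t, s * x b - p b ≤ s * x s - p s) :
    IntegrableOn x (Icc a t) ∧ ∫ s in Icc a t, x s ≤ t * x t - p t := by
  set u : ℝ → ℝ := fun s => s * x s - p s with hu_def
  have hxm : MonotoneOn x (Icc a t) := by
    intro y hy z hz hyz
    rcases hyz.eq_or_lt with rfl | hlt
    · exact le_rfl
    · have h1 := htruth y hy z hz
      have h2 := htruth z hz y hy
      have : 0 ≤ (z - y) * (x z - x y) := by nlinarith
      exact sub_nonneg.1 (nonneg_of_mul_nonneg_right this (sub_pos.2 hlt))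
  -- A bidder of value `z` may report `y`: the allocation is a subgradient of the utility.
  have hstep : ∀ y ∈ Icc a t, ∀ z ∈ Icc a t, (z - y) * x y ≤ u z - u y := by
    intro y hy z hz
    have := htruth z hz y hy
    simp only [hu_def]
    linarith
  have hum : MonotoneOn u (Icc a t) := by
    intro y hy z hz hyz
    have h1 := hstep y hy z hz
    have h2 := mul_nonneg (sub_nonneg.2 hyz) (hx0 y hy)
    linarith
  have hxi : ∀ c ∈ Icc a t, ∀ d ∈ Icc a t, IntervalIntegrable x volume c d := by
    intro c hc d hd
    exact (hxm.mono (uIcc_subset_Icc hc hd)).intervalIntegrable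
  have hui : ∀ c ∈ Icc a t, ∀ d ∈ Icc a t, IntervalIntegrable u volume c d := by
    intro c hc d hd
    exact (hum.mono (uIcc_subset_Icc hc hd)).intervalIntegrable
  have ha : a ∈ Icc a t := left_mem_Icc.2 hat
  have ht : t ∈ Icc a t := right_mem_Icc.2 hat
  refine ⟨(intervalIntegrable_iff_integrableOn_Icc_of_le hat).1 (hxi a ha t ht), ?_⟩
  rw [integral_Icc_eq_integral_Ioc, ← intervalIntegral.integral_of_le hat]
  refine le_of_forall_pos_le_add fun δ hδ => ?_
  have hone : ∀ c ∈ Icc a t, c ≤ t → ∫ s in c..t, x s ≤ t - c := by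
    intro c hc hct
    have := intervalIntegral.integral_mono_on hct (hxi c hc t ht) intervalIntegrable_const
      (g := fun _ => (1 : ℝ)) fun s hs => hx1 s ⟨hc.1.trans hs.1, hs.2⟩
    simpa using this
  rcases le_or_gt (t - a) δ with hle | hlt
  · have := hone a ha hat
    have := hu t ht
    linarith
  · have hc : t - δ ∈ Icc a t := ⟨by linarith, by linarith⟩
    have hd : a + δ ∈ Icc a t := ⟨by linarith, by linarith⟩
    have hshift : IntervalIntegrable (fun y => u (y + δ)) volume a (t - δ) := by
      have := (hui (a + δ) hd t ht).comp_add_right δ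
      simpa using this
    -- Averaging the subgradient inequality over a shift by `δ` avoids differentiating `u`. The
    -- right side telescopes to the integral of `u` over the last interval of length `δ` minus that
    -- over the first, hence is at most `δ u(t)`; the omitted piece of `∫ x` is at most `δ`.
    have h1 : ∫ y in a..(t - δ), δ * x y ≤ ∫ y in a..(t - δ), (u (y + δ) - u y) := by
      refine intervalIntegral.integral_mono_on hc.1 ((hxi a ha _ hc).const_mul δ)
        (hshift.sub (hui a ha _ hc)) fun y hy => ?_
      have := hstep y ⟨hy.1, by linarith [hy.2]⟩ (y + δ) ⟨by linarith [hy.1], by linarith [hy.2]⟩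
      simpa using this
    rw [intervalIntegral.integral_const_mul, intervalIntegral.integral_sub hshift (hui a ha _ hc),
      intervalIntegral.integral_comp_add_right (fun y => u y) δ, sub_add_cancel] at h1
    have h2 := intervalIntegral.integral_add_adjacent_intervals (hui a ha _ hd) (hui _ hd t ht)
    have h3 := intervalIntegral.integral_add_adjacent_intervals (hui a ha _ hc) (hui _ hc t ht)
    have h4 : 0 ≤ ∫ y in a..(a + δ), u y := intervalIntegral.integral_nonneg (by linarith)
      fun y hy => hu y ⟨hy.1, hy.2.trans hd.2⟩
    have h5 : ∫ y in (t - δ)..t, u y ≤ δ * u t := by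
      have := intervalIntegral.integral_mono_on hc.2 (hui _ hc t ht) intervalIntegrable_const
        (g := fun _ => u t) fun s hs => hum ⟨hc.1.trans hs.1, hs.2⟩ ht hs.2
      simpa using this
    have h6 : ∫ y in a..(t - δ), x y ≤ u t := by
      refine le_of_mul_le_mul_left ?_ hδ
      linarith
    have h7 := intervalIntegral.integral_add_adjacent_intervals (hxi a ha _ hc) (hxi _ hc t ht)
    have h8 := hone _ hc hc.2
    linarith

namespace IsMHR

variable (h : IsMHR μ f)
include h

lemma integrable_virtualValue : Integrable (virtualValue μ f) μ :=
  h.integrable_id.sub h.integrable_invHazardReal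

lemma virtualValue_monotoneOn : MonotoneOn (virtualValue μ f) (core μ) := by
  intro x hx y hy hxy
  have h1 := h.invHazardReal_antitoneOn hx hy hxy
  have h2 : ∀ z, virtualValue μ f z = z - invHazardReal μ f z := fun z => rfl
  rw [h2, h2]
  linarith

/-- The expected payment of a single bidder in a truthful mechanism is at most the expected
virtual surplus. -/
lemma integral_pay_le {x p : ℝ → ℝ} (hxm : Measurable x) (hp : Integrable p μ)
    (hx0 : ∀ s ∈ μ.support, 0 ≤ x s) (hx1 : ∀ s ∈ μ.support, x s ≤ 1)
    (hu : ∀ s ∈ μ.support, 0 ≤ s * x s - p s)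
    (htruth : ∀ s ∈ μ.support, ∀ b ∈ μ.support, s * x b - p b ≤ s * x s - p s) :
    ∫ s, p s ∂μ ≤ ∫ s, virtualValue μ f s * x s ∂μ := by
  have := h.isProbabilityMeasure
  have hcs := h.core_subset_support
  have hxb : ∀ᵐ s ∂μ, ‖x s‖ ≤ 1 := by
    filter_upwards [h.ae_mem_core] with s hs
    rw [Real.norm_of_nonneg (hx0 s (hcs hs))]
    exact hx1 s (hcs hs)
  have hix : Integrable (fun s => s * x s) μ :=
    h.integrable_id.mul_bdd (c := 1) hxm.aestronglyMeasurable hxb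
  have hih : Integrable (fun s => x s * invHazardReal μ f s) μ :=
    h.integrable_invHazardReal.bdd_mul (c := 1) hxm.aestronglyMeasurable hxb
  have hiu : Integrable (fun s => s * x s - p s) μ := hix.sub hp
  have hu_ae : 0 ≤ᵐ[μ] fun s => s * x s - p s := h.ae_mem_core.mono fun s hs => hu s (hcs hs)
  -- Truthfulness is available only on the support, so the envelope integral starts at its least
  -- point.
  obtain ⟨a, ha, hale⟩ : ∃ a ∈ μ.support, ∀ s ∈ μ.support, a ≤ s := by
    have hne : μ.support.Nonempty := Measure.nonempty_support (IsProbabilityMeasure.ne_zero μ)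
    have hbdd : BddBelow μ.support := ⟨0, fun s hs => h.support_subset hs⟩
    exact ⟨sInf μ.support, Measure.isClosed_support.csInf_mem hne hbdd, fun s hs => csInf_le hbdd hs⟩
  have hkey : ∀ t ∈ core μ, ∫⁻ s in core μ, (Iio t).indicator (fun s => ENNReal.ofReal (x s)) s ≤
      ENNReal.ofReal (t * x t - p t) := by
    intro t ht
    have hsub : Icc a t ⊆ μ.support := fun s hs =>
      h.ordConnected_support.out ha (hcs ht) hs
    obtain ⟨hi, hle⟩ := integral_alloc_le_utility (hale t (hcs ht)) (fun s hs => hx0 s (hsub hs))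
      (fun s hs => hx1 s (hsub hs)) (fun s hs => hu s (hsub hs))
      (fun s hs b hb => htruth s (hsub hs) b (hsub hb))
    rw [lintegral_indicator measurableSet_Iio, Measure.restrict_restrict measurableSet_Iio]
    calc ∫⁻ s in Iio t ∩ core μ, ENNReal.ofReal (x s)
        ≤ ∫⁻ s in Icc a t, ENNReal.ofReal (x s) :=
          lintegral_mono_set fun s hs => ⟨hale s (hcs hs.2), le_of_lt hs.1⟩
      _ = ENNReal.ofReal (∫ s in Icc a t, x s) := by
          rw [ofReal_integral_eq_lintegral_ofReal hi]
          exact (ae_restrict_iff' measurableSet_Icc).2 (ae_of_all _ fun s hs => hx0 s (hsub hs))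
      _ ≤ _ := ENNReal.ofReal_le_ofReal hle
  -- The left side is `∫ x (1 - F)`. Writing `1 - F(s)` as the mass above `s` and exchanging
  -- integrals gives the mean over `t` of `∫_{s < t} x`, which the utility at `t` dominates.
  have hmain : ∫ s, x s * invHazardReal μ f s ∂μ ≤ ∫ s, (s * x s - p s) ∂μ := by
    rw [← ENNReal.ofReal_le_ofReal_iff (integral_nonneg_of_ae hu_ae),
      ofReal_integral_eq_lintegral_ofReal hiu hu_ae, h.integral_mul_invHazardReal]
    have hnn : ∀ s ∈ core μ, 0 ≤ x s * (1 - cdf μ s) := fun s hs =>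
      mul_nonneg (hx0 s (hcs hs)) (by linarith [hs.2])
    have hint : IntegrableOn (fun s => x s * (1 - cdf μ s)) (core μ) := by
      refine (h.integrableOn_survival.mono_set h.core_subset_Ioi).bdd_mul (c := 1)
        hxm.aestronglyMeasurable ((ae_restrict_iff' h.measurableSet_core).2 (ae_of_all _ ?_))
      intro s hs
      rw [Real.norm_of_nonneg (hx0 s (hcs hs))]
      exact hx1 s (hcs hs)
    rw [ofReal_integral_eq_lintegral_ofReal hint
      ((ae_restrict_iff' h.measurableSet_core).2 (ae_of_all _ hnn))]
    calc ∫⁻ s in core μ, ENNReal.ofReal (x s * (1 - cdf μ s))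
        = ∫⁻ s in core μ, (∫⁻ t, (Iio t).indicator (fun s => ENNReal.ofReal (x s)) s ∂μ) := by
          refine setLIntegral_congr_fun h.measurableSet_core fun s hs => ?_
          have : (fun t => (Iio t).indicator (fun s => ENNReal.ofReal (x s)) s) =
              (Ioi s).indicator fun _ => ENNReal.ofReal (x s) := by
            ext t
            simp [indicator]
          rw [this, lintegral_indicator measurableSet_Ioi, setLIntegral_const,
            ENNReal.ofReal_mul (hx0 s (hcs hs)), ← real_Ioi_eq, ofReal_measureReal]
      _ = ∫⁻ t, (∫⁻ s in core μ, (Iio t).indicator (fun s => ENNReal.ofReal (x s)) s) ∂μ := by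
          refine lintegral_lintegral_swap ?_
          have : (Function.uncurry fun s t => (Iio t).indicator (fun s => ENNReal.ofReal (x s)) s) =
              {q : ℝ × ℝ | q.1 < q.2}.indicator fun q => ENNReal.ofReal (x q.1) := by
            ext ⟨s, t⟩
            simp [Function.uncurry, indicator]
          rw [this]
          exact ((hxm.comp measurable_fst).ennreal_ofReal.indicator
            (measurableSet_lt measurable_fst measurable_snd)).aemeasurable
      _ ≤ ∫⁻ t, ENNReal.ofReal (t * x t - p t) ∂μ :=
          lintegral_mono_ae (h.ae_mem_core.mono hkey)
  rw [integral_sub hix hp] at hmain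
  have hφ : ∫ s, virtualValue μ f s * x s ∂μ =
      ∫ s, s * x s ∂μ - ∫ s, x s * invHazardReal μ f s ∂μ := by
    rw [← integral_sub hix hih]
    refine integral_congr_ae (ae_of_all _ fun s => ?_)
    simp only [virtualValue, invHazardReal]
    ring
  rw [hφ]
  linarith

lemma ae_iidLaw_mem_core (n : ℕ) : ∀ᵐ v ∂(iidLaw μ n), ∀ j, v j ∈ core μ := by
  have := h.isProbabilityMeasure
  rw [ae_all_iff]
  intro j
  exact (measurePreserving_eval (fun _ : Fin n => μ) j).quasiMeasurePreserving.ae h.ae_mem_core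

lemma integrable_virtualValue_mul_alloc {n : ℕ} (A : TruthfulAuction μ n) (i : Fin n) :
    Integrable (fun v => virtualValue μ f (v i) * A.alloc v i) (iidLaw μ n) := by
  have := h.isProbabilityMeasure
  have h1 : Integrable (fun v : Fin n → ℝ => virtualValue μ f (v i)) (iidLaw μ n) :=
    (measurePreserving_eval (fun _ : Fin n => μ) i).integrable_comp_of_integrable
      h.integrable_virtualValue
  refine h1.mul_bdd (c := 1) (A.measurable_alloc i).aestronglyMeasurable ?_
  filter_upwards [h.ae_iidLaw_mem_core n] with v hv
  have hs := fun j => h.core_subset_support (hv j)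
  rw [Real.norm_of_nonneg (A.alloc_nonneg v hs i)]
  exact (Finset.single_le_sum (fun j _ => A.alloc_nonneg v hs j) (Finset.mem_univ i)).trans
    (A.sum_alloc_le_one v hs)

/-- For almost every profile of the other bids, redrawing bid `i` leaves a truthful mechanism for a
single bidder, to which `integral_pay_le` applies. -/
lemma integral_auction_pay_le {n : ℕ} (A : TruthfulAuction μ n) (i : Fin n) :
    ∫ v, A.pay v i ∂(iidLaw μ n) ≤ ∫ v, virtualValue μ f (v i) * A.alloc v i ∂(iidLaw μ n) := by
  have := h.isProbabilityMeasure
  have hmp := measurePreserving_update (μ := μ) i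
  have hip : Integrable (fun z : ℝ × (Fin n → ℝ) => A.pay (Function.update z.2 i z.1) i)
      (μ.prod (iidLaw μ n)) := hmp.integrable_comp_of_integrable (A.integrable_pay i)
  have hia : Integrable (fun z : ℝ × (Fin n → ℝ) =>
      virtualValue μ f (Function.update z.2 i z.1 i) * A.alloc (Function.update z.2 i z.1) i)
      (μ.prod (iidLaw μ n)) :=
      hmp.integrable_comp_of_integrable (h.integrable_virtualValue_mul_alloc A i)
  have hpay : ∫ v, A.pay v i ∂(iidLaw μ n) =
      ∫ v, ∫ s, A.pay (Function.update v i s) i ∂μ ∂(iidLaw μ n) := by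
    conv_lhs => rw [← hmp.map_eq]
    rw [integral_map hmp.measurable.aemeasurable (A.measurable_pay i).aestronglyMeasurable,
      integral_prod_symm _ hip]
  have hvm : Measurable fun v : Fin n → ℝ => virtualValue μ f (v i) * A.alloc v i :=
    (h.measurable_virtualValue.comp (measurable_pi_apply i)).mul (A.measurable_alloc i)
  have hall : ∫ v, virtualValue μ f (v i) * A.alloc v i ∂(iidLaw μ n) =
      ∫ v, ∫ s, virtualValue μ f s * A.alloc (Function.update v i s) i ∂μ ∂(iidLaw μ n) := by
    conv_lhs => rw [← hmp.map_eq]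
    rw [integral_map hmp.measurable.aemeasurable hvm.aestronglyMeasurable,
      integral_prod_symm _ hia]
    simp
  rw [hpay, hall]
  have hia' : Integrable
      (fun v => ∫ s, virtualValue μ f s * A.alloc (Function.update v i s) i ∂μ) (iidLaw μ n) := by
    simpa using hia.integral_prod_right
  refine integral_mono_ae hip.integral_prod_right hia' ?_
  filter_upwards [h.ae_iidLaw_mem_core n, hip.prod_left_ae] with v hv hvi
  have hupd : ∀ s ∈ μ.support, ∀ j, Function.update v i s j ∈ μ.support := by
    intro s hs j
    by_cases hj : j = i
    · subst hj; simpa using hs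
    · simpa [Function.update_of_ne hj] using h.core_subset_support (hv j)
  refine h.integral_pay_le ((A.measurable_alloc i).comp (measurable_update v)) hvi
    (fun s hs => A.alloc_nonneg _ (hupd s hs) i) (fun s hs => ?_) (fun s hs => ?_)
    (fun s hs b hb => ?_)
  · exact (Finset.single_le_sum (fun j _ => A.alloc_nonneg _ (hupd s hs) j)
      (Finset.mem_univ i)).trans (A.sum_alloc_le_one _ (hupd s hs))
  · simpa using A.individuallyRational _ (hupd s hs) i
  · simpa using A.truthful _ (hupd s hs) i b hb

/-- By monotonicity of `φ` on the core, the highest bidder has the largest virtual value, so the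
virtual surplus of a feasible allocation is at most the positive part of that value. -/
lemma optAuction_le_myerson {n : ℕ} (hn : n ≠ 0) : optAuction μ n ≤ myerson μ f n := by
  have := h.isProbabilityMeasure
  have : Nonempty (Fin n) := ⟨⟨0, Nat.pos_of_ne_zero hn⟩⟩
  refine iSup_le fun A => ?_
  have hint : Integrable (fun v => ∑ i, virtualValue μ f (v i) * A.alloc v i) (iidLaw μ n) :=
    integrable_finsetSum _ fun i _ => h.integrable_virtualValue_mul_alloc A i
  have hrev : A.revenue ≤ ∫ v, ∑ i, virtualValue μ f (v i) * A.alloc v i ∂(iidLaw μ n) := by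
    rw [TruthfulAuction.revenue, integral_finsetSum _ fun i _ => A.integrable_pay i,
      integral_finsetSum _ fun i _ => h.integrable_virtualValue_mul_alloc A i]
    exact Finset.sum_le_sum fun i _ => h.integral_auction_pay_le A i
  have hpos : ∫ v, ∑ i, virtualValue μ f (v i) * A.alloc v i ∂(iidLaw μ n) ≤
      ∫ v, max (∑ i, virtualValue μ f (v i) * A.alloc v i) 0 ∂(iidLaw μ n) :=
    integral_mono hint hint.pos_part fun v => le_max_left _ _
  refine (ENNReal.ofReal_le_ofReal (hrev.trans hpos)).trans ?_
  rw [ofReal_integral_eq_lintegral_ofReal hint.pos_part (ae_of_all _ fun v => le_max_right _ _)]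
  refine lintegral_mono_ae ?_
  filter_upwards [h.ae_iidLaw_mem_core n] with v hv
  refine ENNReal.ofReal_le_ofReal (max_le ?_ (le_max_left _ _))
  have hs := fun j => h.core_subset_support (hv j)
  obtain ⟨k, hk⟩ := exists_eq_ciSup_of_finite (f := v)
  have hle : ∀ i, virtualValue μ f (v i) ≤ max 0 (virtualValue μ f (⨆ i, v i)) := by
    intro i
    refine le_trans ?_ (le_max_right _ _)
    refine h.virtualValue_monotoneOn (hv i) (by rw [← hk]; exact hv k) ?_
    exact le_ciSup (Set.finite_range v).bddAbove i
  calc ∑ i, virtualValue μ f (v i) * A.alloc v i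
      ≤ ∑ i, max 0 (virtualValue μ f (⨆ i, v i)) * A.alloc v i :=
        Finset.sum_le_sum fun i _ => mul_le_mul_of_nonneg_right (hle i) (A.alloc_nonneg v hs i)
    _ = max 0 (virtualValue μ f (⨆ i, v i)) * ∑ i, A.alloc v i := by rw [Finset.mul_sum]
    _ ≤ max 0 (virtualValue μ f (⨆ i, v i)) :=
        mul_le_of_le_one_right (le_max_left _ _) (A.sum_alloc_le_one v hs)

end IsMHR

/-! ### Attainment of the bound and numerical estimates. -/

lemma one_sub_pow_pos {n : ℕ} (hn : n ≠ 0) {q : ℝ} (hq0 : 0 < q) (hq1 : q ≤ 1) :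
    0 < 1 - (1 - q) ^ n := by
  have := pow_lt_one₀ (show 0 ≤ 1 - q by linarith) (by linarith) hn
  linarith

lemma one_div_exp_one_mem : (0.36787 : ℝ) < 1 / Real.exp 1 ∧ 1 / Real.exp 1 < 0.36788 := by
  have h1 := Real.exp_one_gt_d9
  have h2 := Real.exp_one_lt_d9
  constructor
  · rw [lt_div_iff₀ (Real.exp_pos 1)]
    linarith
  · rw [div_lt_iff₀ (Real.exp_pos 1)]
    linarith

lemma continuousOn_boundAt {n : ℕ} (hn : n ≠ 0) :
    ContinuousOn (boundAt n) (Icc (1 / Real.exp 1) 1) := by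
  have hne : ∀ q ∈ Icc (1 / Real.exp 1) 1, 1 - (1 - q) ^ n ≠ 0 := fun q hq =>
    (one_sub_pow_pos hn (by linarith [one_div_exp_one_mem.1, hq.1]) hq.2).ne'
  have h1 : ContinuousOn (harmonicSum n) (Icc (1 / Real.exp 1) 1) := fun q _ =>
    (hasDerivAt_harmonicSum n q).continuousAt.continuousWithinAt
  unfold boundAt
  simp only [integral_eq_harmonicSum]
  refine continuous_min.comp_continuousOn (ContinuousOn.prodMk
    (ContinuousOn.add continuousOn_const (ContinuousOn.div ?_ ?_ hne)) (h1.div ?_ hne)) <;> fun_prop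

lemma isGreatest_bound {n : ℕ} (hn : n ≠ 0) :
    IsGreatest (boundAt n '' Icc (1 / Real.exp 1) 1) (bound n) := by
  have hne : (Icc (1 / Real.exp 1) (1 : ℝ)).Nonempty :=
    nonempty_Icc.2 (by linarith [one_div_exp_one_mem.2])
  exact (isCompact_Icc.image_of_continuousOn (continuousOn_boundAt hn)).isGreatest_sSup
    (hne.image _)

lemma bound_le {n : ℕ} (hn : n ≠ 0) {C : ℝ}
    (hC : ∀ q ∈ Icc (1 / Real.exp 1) 1, boundAt n q ≤ C) : bound n ≤ C := by
  obtain ⟨q, hq, hqb⟩ := (isGreatest_bound hn).1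
  rw [← hqb]
  exact hC q hq

/-- Raising to the power `b` reduces estimates of `exp (a / b)` to arithmetic with decimal bounds
for `e`. -/
lemma le_exp {a b : ℕ} (hb : b ≠ 0) {x : ℝ} (hab : x ^ b ≤ 2.7182818283 ^ a) :
    x ≤ Real.exp (a / b : ℝ) := by
  have hb' : (b : ℝ) ≠ 0 := by exact_mod_cast hb
  refine le_of_pow_le_pow_left₀ hb (Real.exp_pos _).le ?_
  rw [← Real.exp_nat_mul, show (b : ℝ) * (a / b) = a by field_simp, ← mul_one (a : ℝ),
    Real.exp_nat_mul]
  exact hab.trans (pow_le_pow_left₀ (by norm_num) Real.exp_one_gt_d9.le a)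

lemma exp_le {a b : ℕ} (hb : b ≠ 0) {x : ℝ} (hx : 0 ≤ x) (hab : 2.7182818286 ^ a ≤ x ^ b) :
    Real.exp (a / b : ℝ) ≤ x := by
  have hb' : (b : ℝ) ≠ 0 := by exact_mod_cast hb
  refine le_of_pow_le_pow_left₀ hb hx ?_
  rw [← Real.exp_nat_mul, show (b : ℝ) * (a / b) = a by field_simp, ← mul_one (a : ℝ),
    Real.exp_nat_mul]
  exact (pow_le_pow_left₀ (Real.exp_pos 1).le Real.exp_one_lt_d9.le a).trans hab

lemma le_exp_neg {a b : ℕ} (hb : b ≠ 0) {x : ℝ} (hx : 0 < x)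
    (hab : x ^ b * 2.7182818286 ^ a ≤ 1) : x ≤ Real.exp (-(a / b : ℝ)) := by
  rw [Real.exp_neg]
  refine (le_inv_comm₀ hx (Real.exp_pos _)).2 (exp_le hb (by positivity) ?_)
  rw [inv_pow, ← one_div, le_div_iff₀ (by positivity)]
  linarith

lemma exp_neg_le {a b : ℕ} (hb : b ≠ 0) {x : ℝ} (hx : 0 < x)
    (hab : 1 ≤ x ^ b * 2.7182818283 ^ a) : Real.exp (-(a / b : ℝ)) ≤ x := by
  rw [Real.exp_neg]
  refine (inv_le_comm₀ hx (Real.exp_pos _)).1 (le_exp hb ?_)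
  rw [inv_pow, ← one_div, div_le_iff₀ (by positivity)]
  linarith

/-- The part of the first term of `boundAt` that does not depend on the quantile. -/
def jensenFactor (n : ℕ) : ℝ := 1 / (1 - (1 - Real.exp (-(harmonic n : ℝ) + 1)) ^ n)

lemma exp_harmonic_lt_one {n : ℕ} (hn : 2 ≤ n) : Real.exp (-(harmonic n : ℝ) + 1) < 1 := by
  rw [Real.exp_lt_one_iff]
  linarith [three_half_le_harmonic hn]

lemma jensenFactor_le_of_pow_le {n : ℕ} {c : ℝ} (hc : c < 1)
    (h : (1 - Real.exp (-(harmonic n : ℝ) + 1)) ^ n ≤ c) : jensenFactor n ≤ 1 / (1 - c) :=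
  one_div_le_one_div_of_le (by linarith) (by linarith)

lemma jensenFactor_le {n : ℕ} (hn : 2 ≤ n) {x : ℝ} (hx0 : 0 < x)
    (hx : x ≤ Real.exp (-(harmonic n : ℝ) + 1)) :
    jensenFactor n ≤ 1 / (1 - (1 - x) ^ n) := by
  have h1 := exp_harmonic_lt_one hn
  refine jensenFactor_le_of_pow_le ?_ (pow_le_pow_left₀ (by linarith) (by linarith) n)
  exact pow_lt_one₀ (by linarith) (by linarith) (by omega)

lemma boundAt_eq {n : ℕ} (hn : n ≠ 0) {q : ℝ} (hq0 : 0 < q) (hq1 : q ≤ 1) :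
    boundAt n q = min
      (jensenFactor n + (1 - q) ^ (n - 1) / ∑ k ∈ Finset.range n, (1 - q) ^ k)
      (harmonicSum n q / (1 - (1 - q) ^ n)) := by
  rw [boundAt, integral_eq_harmonicSum, jensenFactor]
  congr 2
  have h1 := one_sub_pow_pos hn hq0 hq1
  rw [← mul_geom_sum_one_sub] at h1 ⊢
  exact mul_div_mul_left _ _ hq0.ne'

/-- For `y > 0` the quotient is `1 / ∑_{j < n} y^(-j)`, which increases with `y` and decreases with
`n`. Cross-multiplication also covers `y = 0`. -/
lemma pow_div_geom_sum_le {m n : ℕ} (hm : m ≠ 0) (hmn : m ≤ n) {y Y : ℝ} (hy0 : 0 ≤ y)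
    (hyY : y ≤ Y) (hY1 : Y ≤ 1) :
    y ^ (n - 1) / ∑ k ∈ Finset.range n, y ^ k ≤
      Y ^ (m - 1) / ∑ k ∈ Finset.range m, Y ^ k := by
  have hpos : ∀ {l : ℕ} {z : ℝ}, l ≠ 0 → 0 ≤ z → 0 < ∑ k ∈ Finset.range l, z ^ k := by
    intro l z hl hz
    exact geom_sum_pos hz hl
  rw [div_le_div_iff₀ (hpos (by omega) hy0) (hpos hm (hy0.trans hyY))]
  calc y ^ (n - 1) * ∑ k ∈ Finset.range m, Y ^ k
      ≤ y ^ (m - 1) * ∑ k ∈ Finset.range m, Y ^ k := by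
        refine mul_le_mul_of_nonneg_right ?_ (hpos hm (hy0.trans hyY)).le
        exact pow_le_pow_of_le_one hy0 (hyY.trans hY1) (by omega)
    _ = ∑ k ∈ Finset.range m, y ^ (m - 1) * Y ^ k := by rw [Finset.mul_sum]
    _ ≤ ∑ k ∈ Finset.range m, Y ^ (m - 1) * y ^ k := by
        refine Finset.sum_le_sum fun k hk => ?_
        have hk' : k ≤ m - 1 := by
          have := Finset.mem_range.1 hk
          omega
        rw [← Nat.sub_add_cancel hk', pow_add, pow_add, mul_assoc, mul_assoc, mul_comm (y ^ k)]
        refine mul_le_mul_of_nonneg_right (pow_le_pow_left₀ hy0 hyY _) ?_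
        have := hy0.trans hyY
        positivity
    _ = Y ^ (m - 1) * ∑ k ∈ Finset.range m, y ^ k := by rw [Finset.mul_sum]
    _ ≤ Y ^ (m - 1) * ∑ k ∈ Finset.range n, y ^ k := by
        refine mul_le_mul_of_nonneg_left ?_ (pow_nonneg (hy0.trans hyY) _)
        exact Finset.sum_le_sum_of_subset_of_nonneg (Finset.range_subset_range.2 hmn)
          fun k _ _ => pow_nonneg hy0 k

/-- The first term alone, at its worst quantile `q = 1/e`; `0.63213` exceeds `1 - 1/e`. This
suffices for all `n ≥ 4`. -/
lemma bound_le_of_first {m n : ℕ} (hm : m ≠ 0) (hmn : m ≤ n) {A C : ℝ}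
    (hA : jensenFactor n ≤ A)
    (hC : A + 0.63213 ^ (m - 1) / ∑ k ∈ Finset.range m, (0.63213 : ℝ) ^ k ≤ C) :
    bound n ≤ C := by
  refine bound_le (by omega) fun q hq => ?_
  have h1 := one_div_exp_one_mem.1
  rw [boundAt_eq (by omega) (by linarith [hq.1]) hq.2]
  have h2 := pow_div_geom_sum_le hm hmn (y := 1 - q) (Y := 0.63213) (by linarith [hq.2])
    (by linarith [hq.1]) (by norm_num)
  exact (min_le_left _ _).trans (by linarith)

lemma harmonic_three : (harmonic 3 : ℝ) = 11 / 6 := by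
  norm_num [harmonic, Finset.sum_range_succ]

lemma exp_three_ge : (0.43455 : ℝ) ≤ Real.exp (-(harmonic 3 : ℝ) + 1) := by
  have := le_exp_neg (a := 5) (b := 6) (x := 0.43455) (by norm_num) (by norm_num) (by norm_num)
  convert this using 2
  rw [harmonic_three]
  norm_num

lemma le_bound_three : 1.35 ≤ bound 3 := by
  have he := one_div_exp_one_mem.2
  refine le_trans ?_ ((isGreatest_bound (n := 3) (by norm_num)).2
    -- A quantile close to the crossing of the two terms.
    (mem_image_of_mem _ (show (0.52 : ℝ) ∈ Icc (1 / Real.exp 1) 1 from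
      ⟨by linarith, by norm_num⟩)))
  rw [boundAt_eq (by norm_num) (by norm_num) (by norm_num)]
  refine le_min ?_ ?_
  · have h1 := exp_neg_le (a := 5) (b := 6) (x := 0.436) (by norm_num) (by norm_num) (by norm_num)
    have h2 : Real.exp (-(harmonic 3 : ℝ) + 1) ≤ 0.436 := by
      convert h1 using 2
      rw [harmonic_three]
      norm_num
    have h3 := one_sub_pow_pos (n := 3) (by norm_num)
      (Real.exp_pos (-(harmonic 3 : ℝ) + 1)) (by linarith)
    have h4 : (0.564 : ℝ) ^ 3 ≤ (1 - Real.exp (-(harmonic 3 : ℝ) + 1)) ^ 3 :=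
      pow_le_pow_left₀ (by norm_num) (by linarith) 3
    have h5 : 1 / (1 - (0.564 : ℝ) ^ 3) ≤ jensenFactor 3 :=
      one_div_le_one_div_of_le h3 (by linarith)
    norm_num [Finset.sum_range_succ] at h5 ⊢
    linarith
  · norm_num [harmonicSum, Finset.sum_range_succ]

lemma bound_three_le : bound 3 ≤ 1.354 := by
  refine bound_le (by norm_num) fun q hq => ?_
  have he := one_div_exp_one_mem.1
  have hq0 : 0.36787 ≤ q := he.le.trans hq.1
  have hq1 := hq.2
  rw [boundAt_eq (by norm_num) (by linarith) hq1]
  -- Near `0.5237` both terms are just below `1.354`; the second is used to the left of it and the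
  -- first to the right.
  rcases le_total q 0.5237 with h | h
  · refine (min_le_right _ _).trans ?_
    rw [div_le_iff₀ (one_sub_pow_pos (by norm_num) (by linarith) hq1)]
    norm_num [harmonicSum, Finset.sum_range_succ]
    -- This is `1.354 (1 - (1 - q)^3) - harmonicSum 3 q` divided by `q`.
    have h1 : 0 ≤ 1.062 - 2.562 * q + (1.354 - 1 / 3) * q ^ 2 := by nlinarith
    nlinarith [mul_nonneg (show 0 ≤ q by linarith) h1]
  · refine (min_le_left _ _).trans ?_
    have h1 := jensenFactor_le (n := 3) (by norm_num) (by norm_num) exp_three_ge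
    have h2 := pow_div_geom_sum_le (m := 3) (n := 3) (by norm_num) le_rfl (y := 1 - q)
      (Y := 0.4763) (by linarith) (by linarith) (by norm_num)
    refine (add_le_add h1 h2).trans ?_
    norm_num [Finset.sum_range_succ]

lemma bound_two_le : bound 2 ≤ 1.35 := by
  refine bound_le (by norm_num) fun q hq => ?_
  have he := one_div_exp_one_mem.1
  have hq0 : 0.36787 ≤ q := he.le.trans hq.1
  have hq1 := hq.2
  rw [boundAt_eq (by norm_num) (by linarith) hq1]
  -- Neither term stays below `1.35` on the whole range: the first is too large at `1/e` and the
  -- second equals `3/2` at `1`.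
  rcases le_total q 0.815 with h | h
  · refine (min_le_right _ _).trans ?_
    rw [div_le_iff₀ (one_sub_pow_pos (by norm_num) (by linarith) hq1)]
    norm_num [harmonicSum, Finset.sum_range_succ]
    nlinarith
  · refine (min_le_left _ _).trans ?_
    have hx : (0.6065 : ℝ) ≤ Real.exp (-(harmonic 2 : ℝ) + 1) := by
      have := le_exp_neg (a := 1) (b := 2) (x := 0.6065) (by norm_num) (by norm_num) (by norm_num)
      convert this using 2
      norm_num [harmonic, Finset.sum_range_succ]
    have h1 := jensenFactor_le (n := 2) (by norm_num) (by norm_num) hx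
    have h2 := pow_div_geom_sum_le (m := 2) (n := 2) (by norm_num) le_rfl (y := 1 - q)
      (Y := 0.185) (by linarith) (by linarith) (by norm_num)
    refine (add_le_add h1 h2).trans ?_
    norm_num [Finset.sum_range_succ]

lemma bound_four_le : bound 4 ≤ 1.35 := by
  have hx : (0.338 : ℝ) ≤ Real.exp (-(harmonic 4 : ℝ) + 1) := by
    have := le_exp_neg (a := 13) (b := 12) (x := 0.338) (by norm_num) (by norm_num) (by norm_num)
    convert this using 2
    norm_num [harmonic, Finset.sum_range_succ]
  refine bound_le_of_first (m := 4) (by norm_num) le_rfl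
    (jensenFactor_le (by norm_num) (by norm_num) hx) ?_
  norm_num [Finset.sum_range_succ]

lemma bound_five_le : bound 5 ≤ 1.35 := by
  have hx : (0.27 : ℝ) ≤ Real.exp (-(harmonic 5 : ℝ) + 1) := by
    have := le_exp_neg (a := 13) (b := 10) (x := 0.27) (by norm_num) (by norm_num) (by norm_num)
    refine this.trans (Real.exp_le_exp.2 ?_)
    norm_num [harmonic, Finset.sum_range_succ]
  refine bound_le_of_first (m := 5) (by norm_num) le_rfl
    (jensenFactor_le (by norm_num) (by norm_num) hx) ?_
  norm_num [Finset.sum_range_succ]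

lemma bound_six_le : bound 6 ≤ 1.35 := by
  have hx : (0.22 : ℝ) ≤ Real.exp (-(harmonic 6 : ℝ) + 1) := by
    have := le_exp_neg (a := 3) (b := 2) (x := 0.22) (by norm_num) (by norm_num) (by norm_num)
    refine this.trans (Real.exp_le_exp.2 ?_)
    norm_num [harmonic, Finset.sum_range_succ]
  refine bound_le_of_first (m := 6) (by norm_num) le_rfl
    (jensenFactor_le (by norm_num) (by norm_num) hx) ?_
  norm_num [Finset.sum_range_succ]

/-- The sequence `n exp (1 - H_n)` is nondecreasing because `exp (-1 / (n + 1)) ≥ n / (n + 1)`, so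
its value at `7` is a lower bound. -/
lemma le_mul_exp_harmonic {n : ℕ} (hn : 7 ≤ n) :
    1.42 ≤ n * Real.exp (-(harmonic n : ℝ) + 1) := by
  induction n, hn using Nat.le_induction with
  | base =>
    have h1 := le_exp_neg (a := 51) (b := 32) (x := 0.203) (by norm_num) (by norm_num) (by norm_num)
    have h2 : (0.203 : ℝ) ≤ Real.exp (-(harmonic 7 : ℝ) + 1) := by
      refine h1.trans (Real.exp_le_exp.2 ?_)
      norm_num [harmonic, Finset.sum_range_succ]
    push_cast
    linarith
  | succ n hn ih =>
    rw [harmonic_succ]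
    push_cast
    have hn1 : (0 : ℝ) < n + 1 := by positivity
    have h1 : (n : ℝ) ≤ (n + 1) * Real.exp (-((n : ℝ) + 1)⁻¹) := by
      have h2 := Real.add_one_le_exp (-((n : ℝ) + 1)⁻¹)
      have h3 := mul_le_mul_of_nonneg_left h2 hn1.le
      have h4 : ((n : ℝ) + 1) * (-((n : ℝ) + 1)⁻¹ + 1) = n := by
        field_simp
        ring
      linarith
    rw [show -((harmonic n : ℝ) + ((n : ℝ) + 1)⁻¹) + 1 =
      -((n : ℝ) + 1)⁻¹ + (-(harmonic n : ℝ) + 1) by ring, Real.exp_add, ← mul_assoc]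
    exact ih.trans (mul_le_mul_of_nonneg_right h1 (Real.exp_pos _).le)

/-- Uniformly in `n`, `(1 - x)^n ≤ exp (-n x) ≤ exp (-1.42)`, and the remaining summand is largest
at `n = 7`. -/
lemma bound_le_of_seven_le {n : ℕ} (hn : 7 ≤ n) : bound n ≤ 1.35 := by
  set x := Real.exp (-(harmonic n : ℝ) + 1) with hx
  have h1 : (1 - x) ^ n ≤ 0.2425 := by
    have h2 : 1 - x ≤ Real.exp (-x) := by linarith [Real.add_one_le_exp (-x)]
    have h3 := exp_harmonic_lt_one (n := n) (by omega)
    have h4 := exp_neg_le (a := 71) (b := 50) (x := 0.2425) (by norm_num) (by norm_num)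
      (by norm_num)
    refine (pow_le_pow_left₀ (by linarith) h2 n).trans (le_trans ?_ h4)
    rw [← Real.exp_nat_mul]
    refine Real.exp_le_exp.2 ?_
    have h5 := le_mul_exp_harmonic hn
    rw [← hx] at h5
    norm_num at h5 ⊢
    linarith
  refine bound_le_of_first (m := 7) (by norm_num) hn
    (jensenFactor_le_of_pow_le (by norm_num) h1) ?_
  norm_num [Finset.sum_range_succ]

lemma bound_le_bound_three {n : ℕ} (hn : 2 ≤ n) : bound n ≤ bound 3 := by
  by_cases h7 : 7 ≤ n
  · exact (bound_le_of_seven_le h7).trans le_bound_three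
  · have h : n = 2 ∨ n = 3 ∨ n = 4 ∨ n = 5 ∨ n = 6 := by omega
    rcases h with rfl | rfl | rfl | rfl | rfl
    · exact bound_two_le.trans le_bound_three
    · exact le_rfl
    · exact bound_four_le.trans le_bound_three
    · exact bound_five_le.trans le_bound_three
    · exact bound_six_le.trans le_bound_three

lemma IsMHR.myerson_le_bound (h : IsMHR μ f) {n : ℕ} (hn : 2 ≤ n) :
    myerson μ f n ≤ ENNReal.ofReal (bound n) * optPrice μ n := by
  obtain ⟨q, hq, hle⟩ := h.myerson_le_boundAt hn
  refine hle.trans (mul_le_mul_left ?_ _)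
  exact ENNReal.ofReal_le_ofReal
    ((isGreatest_bound (n := n) (by omega)).2 (mem_image_of_mem _ hq))

end AnonymousPricing

end

/-- Upper bound on the approximation ratio of anonymous pricing for `n ≥ 2` i.i.d. bidders with
a continuous MHR valuation distribution. The optimal revenue is both the expected positive
virtual value of the highest bidder (`apx`) and the supremum over all truthful auctions
(`optAuction`). The first clause says that the supremum defining `bound n` is a maximum. -/
theorem mainTheorem2 :
    (∀ n : ℕ, 2 ≤ n →
      IsGreatest (AnonymousPricing.boundAt n '' Set.Icc (1 / Real.exp 1) 1)
        (AnonymousPricing.bound n)) ∧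
    (∀ (n : ℕ), 2 ≤ n → ∀ (μ : MeasureTheory.Measure ℝ) (f : ℝ → ℝ),
      AnonymousPricing.IsMHR μ f →
        0 < AnonymousPricing.optPrice μ n ∧
        AnonymousPricing.optPrice μ n < ⊤ ∧
        AnonymousPricing.apx μ f n ≤ ENNReal.ofReal (AnonymousPricing.bound n) ∧
        AnonymousPricing.optAuction μ n / AnonymousPricing.optPrice μ n
          ≤ ENNReal.ofReal (AnonymousPricing.bound n)) ∧
    (∀ n : ℕ, 2 ≤ n → AnonymousPricing.bound n ≤ AnonymousPricing.bound 3) ∧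
    AnonymousPricing.bound 3 ≤ 1.354 := by
  refine ⟨fun n hn => AnonymousPricing.isGreatest_bound (by omega), fun n hn μ f h =>
    ⟨h.optPrice_pos (by omega), h.optPrice_lt_top, ?_, ?_⟩,
    fun n hn => AnonymousPricing.bound_le_bound_three hn, AnonymousPricing.bound_three_le⟩
  · exact ENNReal.div_le_of_le_mul (h.myerson_le_bound hn)
  · exact ENNReal.div_le_of_le_mul
      ((h.optAuction_le_myerson (by omega)).trans (h.myerson_le_bound hn))
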